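/- **Conventions.** For a homomorphism of groups $f:\Gamma\to G$, the groups $H_*(G,\Gamma)$ denote the relative integral homology of $f$, i.e. the homology of the mapping cone of the chain map $C_*(\Gamma;\mathbb Z)\to C_*(G;\mathbb Z)$ induced by $f$ on the (inhomogeneous) bar complexes with trivial coefficients. An *$f$-extension* of $G$ is a group $E$ with a surjective homomorphism $p:E\twoheadrightarrow G$ and a homomorphism $\psi:\Gamma\to E$ (the structure map) such that $p\circ\psi=f$; it is *central* if $\ker p$ is central in $E$, and *hypercentral* if $p$ is (up to isomorphism) a composition $E_n\to E_{n-1}\to\cdots\to E_0=G$ of finitely many surjections $E_{i+1}\twoheadrightarrow E_i$ with central kernel. A *map of $f$-extensions* $E\to E'$ is a homomorphism commuting with the projections to $G$ and with the structure maps from $\Gamma$. A *universal central $f$-extension* is a central $f$-extension with a unique map of $f$-extensions to every central $f$-extension of $G$. For a group $E$ with structure map $\psi:\Gamma\to E$, $H_i(E,\Gamma)$ is taken with respect to $\psi$. **Theorem.** Let $f:\Gamma\to G$ be a homomorphism of finite groups such that the induced map $f_{ab}:\Gamma_{ab}\to G_{ab}$ on abelianizations is surjective. Then universal central extensions can be taken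 repeatedly: there is a tower $$\cdots\twoheadrightarrow U_{n+1}\twoheadrightarrow U_n\twoheadrightarrow\cdots\twoheadrightarrow U_1\twoheadrightarrow U_0=G$$ with compatible structure maps $\eta_n:\Gamma\to U_n$, $\eta_0=f$, in which $U_{n+1}$ is a universal central $\eta_n$-extension of $U_n$ for every $n\ge 0$. For every such tower, the kernel of $U_{n+1}\to U_n$ is isomorphic to $H_2(U_n,\Gamma)$ for every $n\ge0$, and the inverse limit $U_\infty=\varprojlim U_n$, with the induced maps $\Gamma\to U_\infty\to G$, has the following properties. 1. $U_\infty$ is a finite group, and there is $N>0$ such that the projection $U_\infty\to U_n$ is an isomorphism for all $n\ge N$; in particular $U_\infty=U_N$. 2. $U_\infty$ is a hypercentral $f$-extension of $G$, and it is initial (universal) among these: for every hypercentral $f$-extension $M$ of $G$ there is a unique map of $f$-extensions $U_\infty\to M$. 3. $H_1(U_\infty,\Gamma)=H_2(U_\infty,\Gamma)=0$. 4. $U_\infty$ is terminal among the $f$-extensions with this vanishing property: for every $f$-extension $\Gamma\to E\twoheadrightarrow G$ with $H_1(E,\Gamma)=H_2(E,\Gamma)=0$ there is a unique map of $f$-extensions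 $E\to U_\infty$. -/

import Mathlib

universe u v w

/-! ### Relative integral homology of a group homomorphism, in degrees one and two

`C_n(G)` is the free abelian group on `n`-tuples of elements of `G` (the inhomogeneous bar complex
with trivial integral coefficients). The relative complex of `f : Γ →* G` is the mapping cone
`C_n(G, Γ) = C_n(G) ⊕ C_{n-1}(Γ)`, `d (x, y) = (d x - f y, - d y)`. -/

section RelativeHomology

variable {Γ : Type u} {G : Type v} [Group Γ] [Group G]

/-- The bar differential `C_1(G) → C_0(G)`; it vanishes for trivial coefficients. -/
noncomputable def barD₁ (G : Type v) : (G →₀ ℤ) →ₗ[ℤ] ℤ := 0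

/-- The bar differential `C_2(G) → C_1(G)`, `[g|h] ↦ [h] - [gh] + [g]`. -/
noncomputable def barD₂ (G : Type v) [Group G] : (G × G →₀ ℤ) →ₗ[ℤ] (G →₀ ℤ) :=
  Finsupp.linearCombination ℤ fun x : G × G =>
    Finsupp.single x.2 1 - Finsupp.single (x.1 * x.2) 1 + Finsupp.single x.1 1

/-- The bar differential `C_3(G) → C_2(G)`, `[g|h|k] ↦ [h|k] - [gh|k] + [g|hk] - [g|h]`. -/
noncomputable def barD₃ (G : Type v) [Group G] : (G × G × G →₀ ℤ) →ₗ[ℤ] (G × G →₀ ℤ) :=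
  Finsupp.linearCombination ℤ fun x : G × G × G =>
    Finsupp.single (x.2.1, x.2.2) 1 - Finsupp.single (x.1 * x.2.1, x.2.2) 1
      + Finsupp.single (x.1, x.2.1 * x.2.2) 1 - Finsupp.single (x.1, x.2.1) 1

/-- The map `C_1(Γ) → C_1(G)` induced by `f`. -/
noncomputable def barMap₁ (f : Γ →* G) : (Γ →₀ ℤ) →ₗ[ℤ] (G →₀ ℤ) :=
  Finsupp.lmapDomain ℤ ℤ f

/-- The map `C_2(Γ) → C_2(G)` induced by `f`. -/
noncomputable def barMap₂ (f : Γ →* G) : (Γ × Γ →₀ ℤ) →ₗ[ℤ] (G × G →₀ ℤ) :=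
  Finsupp.lmapDomain ℤ ℤ (Prod.map f f)

/-- The differential `C_1(G) ⊕ C_0(Γ) → C_0(G)` of the mapping cone of `f`. The induced map
`C_0(Γ) → C_0(G)` is the identity of `ℤ`. -/
noncomputable def relD₁ (_f : Γ →* G) : (G →₀ ℤ) × ℤ →ₗ[ℤ] ℤ :=
  barD₁ G ∘ₗ LinearMap.fst ℤ _ _ - LinearMap.snd ℤ _ _

/-- The differential `C_2(G) ⊕ C_1(Γ) → C_1(G) ⊕ C_0(Γ)` of the mapping cone of `f`. -/
noncomputable def relD₂ (f : Γ →* G) : (G × G →₀ ℤ) × (Γ →₀ ℤ) →ₗ[ℤ] (G →₀ ℤ) × ℤ :=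
  (barD₂ G ∘ₗ LinearMap.fst ℤ _ _ - barMap₁ f ∘ₗ LinearMap.snd ℤ _ _).prod
    (-(barD₁ Γ ∘ₗ LinearMap.snd ℤ _ _))

/-- The differential `C_3(G) ⊕ C_2(Γ) → C_2(G) ⊕ C_1(Γ)` of the mapping cone of `f`. -/
noncomputable def relD₃ (f : Γ →* G) :
    (G × G × G →₀ ℤ) × (Γ × Γ →₀ ℤ) →ₗ[ℤ] (G × G →₀ ℤ) × (Γ →₀ ℤ) :=
  (barD₃ G ∘ₗ LinearMap.fst ℤ _ _ - barMap₂ f ∘ₗ LinearMap.snd ℤ _ _).prod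
    (-(barD₂ Γ ∘ₗ LinearMap.snd ℤ _ _))

theorem barMap₁_barD₂ (f : Γ →* G) : barMap₁ f ∘ₗ barD₂ Γ = barD₂ G ∘ₗ barMap₂ f := by
  ext x : 2
  simp [barD₂, barMap₁, barMap₂, Finsupp.mapDomain_single, Finsupp.mapDomain_add, sub_eq_add_neg,
    ← Finsupp.single_neg]

theorem barD₂_barD₃ (G : Type v) [Group G] : barD₂ G ∘ₗ barD₃ G = 0 := by
  ext x : 2
  simp [barD₂, barD₃, mul_assoc]
  abel

theorem relD₁_relD₂ (f : Γ →* G) : relD₁ f ∘ₗ relD₂ f = 0 := by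
  apply LinearMap.ext
  intro x
  simp [relD₁, relD₂, barD₁]

theorem relD₂_relD₃ (f : Γ →* G) : relD₂ f ∘ₗ relD₃ f = 0 := by
  apply LinearMap.ext
  rintro ⟨x, y⟩
  have h₁ : barD₂ G (barD₃ G x) = 0 := LinearMap.congr_fun (barD₂_barD₃ G) x
  have h₂ : barMap₁ f (barD₂ Γ y) = barD₂ G (barMap₂ f y) :=
    LinearMap.congr_fun (barMap₁_barD₂ f) y
  simp [relD₂, relD₃, barD₁, h₁, h₂]

/-- The first relative homology group `H_1(G, Γ; ℤ)` of `f : Γ →* G`. -/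
abbrev RelH₁ (f : Γ →* G) : Type v :=
  LinearMap.ker (relD₁ f) ⧸ (LinearMap.range (relD₂ f)).submoduleOf (LinearMap.ker (relD₁ f))

/-- The second relative homology group `H_2(G, Γ; ℤ)` of `f : Γ →* G`. -/
abbrev RelH₂ (f : Γ →* G) : Type (max u v) :=
  LinearMap.ker (relD₂ f) ⧸ (LinearMap.range (relD₃ f)).submoduleOf (LinearMap.ker (relD₂ f))

end RelativeHomology

/-! ### Extensions under a fixed homomorphism -/

section Extensions

/-- A central extension of `G`: a surjection onto `G` with central kernel. -/
def IsCentralExtension {E : Type w} {G : Type v} [Group E] [Group G] (p : E →* G) : Prop :=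
  Function.Surjective p ∧ p.ker ≤ Subgroup.center E

/-- `p : E →* G` is a hypercentral extension: up to isomorphism it is a composition
`E_n → E_{n-1} → ⋯ → E_1 → E_0 = G` of finitely many (possibly zero) central extensions
`E_{i+1} → E_i`. -/
inductive IsHypercentralExtension {G : Type v} [Group G] :
    ∀ (E : Type w) [Group E], (E →* G) → Prop
  | of_equiv (E : Type w) [Group E] (e : E ≃* G) : IsHypercentralExtension E e.toMonoidHom
  | comp_central (E E' : Type w) [Group E] [Group E'] (p : E →* G) (q : E' →* E) :
      IsHypercentralExtension E p → IsCentralExtension q → IsHypercentralExtension E' (p.comp q)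

variable {Γ : Type u} {G : Type v} [Group Γ] [Group G]

/-- `(E, ψ)` with projection `p : E →* G` is an `f`-extension of `G`: the map `p` is surjective and
the structure map `ψ : Γ →* E` factorizes `f` through `p`. -/
def IsFExtension {E : Type w} [Group E] (f : Γ →* G) (ψ : Γ →* E) (p : E →* G) : Prop :=
  Function.Surjective p ∧ p.comp ψ = f

/-- `τ : E →* E'` is a map of `f`-extensions `(E, ψ, p) → (E', ψ', p')`: it is compatible with the
projections to `G` and with the structure maps from `Γ`. -/
def IsFExtensionHom {E : Type w} {E' : Type*} [Group E] [Group E'] (ψ : Γ →* E) (p : E →* G)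
    (ψ' : Γ →* E') (p' : E' →* G) (τ : E →* E') : Prop :=
  p'.comp τ = p ∧ τ.comp ψ = ψ'

/-- `(U, η)` with projection `p` is a universal central `f`-extension of `G`: a central
`f`-extension that has a unique map of `f`-extensions to every central `f`-extension of `G`. -/
def IsUniversalCentralFExtension {Γ G U : Type u} [Group Γ] [Group G] [Group U]
    (f : Γ →* G) (η : Γ →* U) (p : U →* G) : Prop :=
  (IsFExtension f η p ∧ IsCentralExtension p) ∧
    ∀ (E : Type u) [Group E] (ψ : Γ →* E) (q : E →* G), IsFExtension f ψ q → IsCentralExtension q →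
      ∃! τ : U →* E, IsFExtensionHom η p ψ q τ

end Extensions

/-- The tower `⋯ → U_{n+1} → U_n → ⋯ → U_1 → U_0 = G` under `Γ` obtained from `f : Γ →* G` by
repeatedly taking universal central extensions: `U_{n+1}` is a universal central `η_n`-extension of
`U_n`, where `η_n : Γ →* U_n` is the structure map of the previous stage and `η_0 = f`. -/
structure RelativeSchurTower {Γ G : Type u} [Group Γ] [Group G] (f : Γ →* G) where
  U : ℕ → Type u
  [group : ∀ n, Group (U n)]
  η : ∀ n, Γ →* U n
  p : ∀ n, U (n + 1) →* U n
  base : U 0 ≃* G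
  base_η : base.toMonoidHom.comp (η 0) = f
  universal : ∀ n, IsUniversalCentralFExtension (η n) (η (n + 1)) (p n)

namespace RelativeSchurTower

attribute [instance] RelativeSchurTower.group

variable {Γ G : Type u} [Group Γ] [Group G] {f : Γ →* G} (T : RelativeSchurTower f)

/-- The inverse limit `U_∞` of the tower. -/
def limit : Subgroup (∀ n, T.U n) where
  carrier := {x | ∀ n, T.p n (x (n + 1)) = x n}
  mul_mem' := by
    intro x y hx hy n
    simp [hx n, hy n]
  one_mem' := by
    intro n
    simp
  inv_mem' := by
    intro x hx n
    simp [hx n]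

/-- The projection `U_∞ → U_n`. -/
def limitProj (n : ℕ) : T.limit →* T.U n :=
  (Pi.evalMonoidHom T.U n).comp T.limit.subtype

/-- The structure map `η_∞ : Γ → U_∞`. -/
def limitη : Γ →* T.limit :=
  (MonoidHom.pi T.η).codRestrict T.limit fun γ n =>
    DFunLike.congr_fun (T.universal n).1.1.2 γ

/-- The projection `U_∞ → U_0 = G`. -/
def limitMap : T.limit →* G :=
  T.base.toMonoidHom.comp (T.limitProj 0)

end RelativeSchurTower

/-! Surjectivity of `Abelianization.map f` says exactly that H_1(G, Γ) = 0: the relative boundary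
C_2(G) ⊕ C_1(Γ) → C_1(G) is onto. As C_1(G) is free, the boundary has a section σ, hence the
2-chains project onto H_2(G, Γ). This projection is a relative cocycle and defines a central
extension of G by H_2(G, Γ). Any lifting problem through a central extension yields a relative
cocycle that can be normalized to vanish on σ, so that it factors through H_2
(`exists_normalized_lift`). This makes the extension universal and, when H_2 = 0, solves the lifting
problem. Lifts are unique because two of them differ by a homomorphism to an abelian group that is
trivial on Γ.

The heart is that the tower stabilizes, since the orders of its stages are bounded
(`exists_card_le_of_isHypercentralExtension`). Let K be the kernel of a stage U → G. For a prime ℓ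
the quotient U/O^ℓ(U) is an ℓ-group, hence nilpotent, so Γ surjects onto it and the index of O^ℓ(U)
divides |Γ|. Elements of coprime orders commute if one lies in K, so the ℓ-elements of K centralize
O^ℓ(U). Hence K meets L, the intersection of the O^ℓ(U) over the primes dividing |Γ|, in an abelian
group, and L has bounded index. The transfer shows that |Γ||G| kills K. Since U is generated by at
most |Γ| + |G| elements, the rank of K ∩ L is bounded by Schreier's lemma. Bounded rank and exponent
bound the order of K ∩ L, hence of U.

The limit is then isomorphic to a stage and is its own universal central extension, so its H_2
vanishes. Lifting through hypercentral extensions one central layer at a time gives both universal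
properties. -/

/-! ### Surjectivity on abelianizations -/

section AbelianizationSurjective

variable {Γ : Type u} {G : Type v} [Group Γ] [Group G]

/-- If `f` is surjective on abelianizations, then a homomorphism from `G` to a commutative group is
determined by its restriction along `f`. -/
theorem eq_one_of_comp_eq_one {f : Γ →* G} (hf : Function.Surjective (Abelianization.map f))
    {A : Type*} [CommGroup A] (φ : G →* A) (h : φ.comp f = 1) : φ = 1 := by
  ext g
  obtain ⟨a, ha⟩ := hf (Abelianization.of g)
  induction a using QuotientGroup.induction_on with
  | H γ =>
    have h1 := congrArg (Abelianization.lift φ) ha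
    have h2 : Abelianization.map f (Abelianization.of γ) = Abelianization.of (f γ) := rfl
    change Abelianization.lift φ (Abelianization.map f (Abelianization.of γ)) = _ at h1
    rw [h2, Abelianization.lift_apply_of, Abelianization.lift_apply_of] at h1
    rw [← h1]
    exact DFunLike.congr_fun h γ

/-- It suffices to test on the cokernel of the abelianized map. -/
theorem abelianization_map_surjective_of_forall {f : Γ →* G}
    (h : ∀ (A : Type v) [CommGroup A] (φ : G →* A), φ.comp f = 1 → φ = 1) :
    Function.Surjective (Abelianization.map f) := by
  rw [← MonoidHom.range_eq_top]
  have h1 := h (Abelianization G ⧸ (Abelianization.map f).range)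
    ((QuotientGroup.mk' _).comp Abelianization.of) (by
      ext γ
      simp only [MonoidHom.comp_apply, QuotientGroup.mk'_apply, MonoidHom.one_apply]
      rw [QuotientGroup.eq_one_iff]
      exact ⟨Abelianization.of γ, rfl⟩)
  rw [eq_top_iff]
  intro a _
  induction a using QuotientGroup.induction_on with
  | H g => exact (QuotientGroup.eq_one_iff _).1 (DFunLike.congr_fun h1 g)

/-- A homomorphism which is surjective on abelianizations stays so after a surjection. -/
theorem abelianization_map_comp_surjective {H : Type w} [Group H] {f : Γ →* G}
    (hf : Function.Surjective (Abelianization.map f)) {q : G →* H} (hq : Function.Surjective q) :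
    Function.Surjective (Abelianization.map (q.comp f)) := by
  refine abelianization_map_surjective_of_forall fun A _ φ h => ?_
  have h1 := eq_one_of_comp_eq_one hf (φ.comp q) h
  ext x
  obtain ⟨g, rfl⟩ := hq x
  exact DFunLike.congr_fun h1 g

end AbelianizationSurjective

/-! ### Relative cycles, H_1, and the projection onto H_2 -/

section RelativeHomologyComputations

theorem relChain₂_hom_ext {G : Type*} {Γ : Type*} {A : Type*} [AddCommGroup A]
    {κ κ' : (G × G →₀ ℤ) × (Γ →₀ ℤ) →ₗ[ℤ] A}
    (h₁ : ∀ g h, κ (Finsupp.single (g, h) 1, 0) = κ' (Finsupp.single (g, h) 1, 0))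
    (h₂ : ∀ γ, κ (0, Finsupp.single γ 1) = κ' (0, Finsupp.single γ 1)) : κ = κ' := by
  apply LinearMap.prod_ext
  · ext ⟨g, h⟩
    simpa using h₁ g h
  · ext γ
    simpa using h₂ γ

variable {Γ : Type u} {G : Type v} [Group Γ] [Group G]

/-- The relative differential `C_2(G) ⊕ C_1(Γ) → C_1(G)`. -/
noncomputable def relBoundary (f : Γ →* G) : (G × G →₀ ℤ) × (Γ →₀ ℤ) →ₗ[ℤ] (G →₀ ℤ) :=
  barD₂ G ∘ₗ LinearMap.fst ℤ _ _ - barMap₁ f ∘ₗ LinearMap.snd ℤ _ _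

theorem relD₂_apply (f : Γ →* G) (x) : relD₂ f x = (relBoundary f x, 0) := by
  simp [relD₂, relBoundary, barD₁]

theorem mem_ker_relD₂ {f : Γ →* G} {x} : x ∈ LinearMap.ker (relD₂ f) ↔ relBoundary f x = 0 := by
  rw [LinearMap.mem_ker, relD₂_apply, Prod.mk_eq_zero]
  simp

@[simp]
theorem relBoundary_single_left (f : Γ →* G) (g h : G) :
    relBoundary f (Finsupp.single (g, h) 1, 0) =
      Finsupp.single h 1 - Finsupp.single (g * h) 1 + Finsupp.single g 1 := by
  simp [relBoundary, barD₂]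

@[simp]
theorem relBoundary_single_right (f : Γ →* G) (γ : Γ) :
    relBoundary f (0, Finsupp.single γ 1) = - Finsupp.single (f γ) 1 := by
  simp [relBoundary, barMap₁, Finsupp.mapDomain_single]

theorem relD₃_single_left (f : Γ →* G) (g h k : G) :
    relD₃ f (Finsupp.single (g, h, k) 1, 0) =
      (Finsupp.single (h, k) 1, 0) - (Finsupp.single (g * h, k) 1, 0)
        + (Finsupp.single (g, h * k) 1, 0) - (Finsupp.single (g, h) 1, 0) := by
  simp [relD₃, barD₃]

theorem relD₃_single_right (f : Γ →* G) (γ δ : Γ) :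
    relD₃ f (0, Finsupp.single (γ, δ) 1) =
      - (Finsupp.single (f γ, f δ) 1, 0) - ((0, Finsupp.single δ 1) - (0, Finsupp.single (γ * δ) 1)
        + (0, Finsupp.single γ 1)) := by
  simp [relD₃, barD₂, barMap₂, Finsupp.mapDomain_single]

/-- In the cokernel of the boundary, the class of [g] is multiplicative in g and trivial on the
image of Γ, hence zero. -/
theorem relBoundary_surjective {f : Γ →* G} (hf : Function.Surjective (Abelianization.map f)) :
    Function.Surjective (relBoundary f) := by
  rw [← LinearMap.range_eq_top, ← Submodule.ker_mkQ (LinearMap.range (relBoundary f)),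
    LinearMap.ker_eq_top]
  let φ : G →* Multiplicative ((G →₀ ℤ) ⧸ LinearMap.range (relBoundary f)) :=
    MonoidHom.mk' (fun g => Multiplicative.ofAdd (Submodule.Quotient.mk (Finsupp.single g 1))) (by
      intro g h
      rw [← ofAdd_add, ← Submodule.Quotient.mk_add]
      congr 1
      rw [Submodule.Quotient.eq, ← neg_mem_iff]
      refine ⟨(Finsupp.single (g, h) 1, 0), ?_⟩
      rw [relBoundary_single_left]
      abel)
  have h1 : φ = 1 := eq_one_of_comp_eq_one hf φ (by
    refine MonoidHom.ext fun γ => Multiplicative.toAdd.injective ?_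
    change Submodule.Quotient.mk _ = (0 : _ ⧸ _)
    rw [Submodule.Quotient.mk_eq_zero, ← neg_mem_iff]
    exact ⟨(0, Finsupp.single γ 1), relBoundary_single_right f γ⟩)
  refine Finsupp.lhom_ext' fun g => LinearMap.ext_ring ?_
  exact congrArg Multiplicative.toAdd (DFunLike.congr_fun h1 g)

theorem subsingleton_relH₁_iff (f : Γ →* G) :
    Subsingleton (RelH₁ f) ↔ Function.Surjective (Abelianization.map f) := by
  rw [Submodule.Quotient.subsingleton_iff, Submodule.submoduleOf,
    Submodule.comap_subtype_eq_top]
  constructor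
  · intro h
    refine abelianization_map_surjective_of_forall fun A _ φ hφ => ?_
    let α : (G →₀ ℤ) →ₗ[ℤ] Additive A :=
      Finsupp.linearCombination ℤ fun g => Additive.ofMul (φ g)
    have hα : α ∘ₗ relBoundary f = 0 := by
      apply relChain₂_hom_ext
      · intro g h
        simp only [LinearMap.comp_apply, relBoundary_single_left, map_add, map_sub, α,
          Finsupp.linearCombination_single, one_smul, map_mul, ofMul_mul, LinearMap.zero_apply]
        abel
      · intro γ
        have : φ (f γ) = 1 := DFunLike.congr_fun hφ γ
        simp [α, this]
    ext g
    obtain ⟨y, hy⟩ := h (show (Finsupp.single g 1, 0) ∈ LinearMap.ker (relD₁ f) by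
      simp [relD₁, barD₁])
    rw [relD₂_apply] at hy
    have h2 := LinearMap.congr_fun hα y
    rw [LinearMap.comp_apply, show relBoundary f y = _ from congrArg Prod.fst hy] at h2
    simpa [α] using h2
  · rintro hf ⟨x, n⟩ hx
    obtain ⟨y, hy⟩ := relBoundary_surjective hf x
    have hn : n = 0 := by simpa [relD₁, barD₁] using hx
    exact ⟨y, by rw [relD₂_apply, hy, hn]⟩

theorem exists_relBoundary_section {f : Γ →* G}
    (hf : Function.Surjective (Abelianization.map f)) :
    ∃ σ : (G →₀ ℤ) →ₗ[ℤ] (G × G →₀ ℤ) × (Γ →₀ ℤ), relBoundary f ∘ₗ σ = LinearMap.id :=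
  Module.projective_lifting_property _ _ (relBoundary_surjective hf)

theorem relBoundary_relD₃ (f : Γ →* G) (x) : relBoundary f (relD₃ f x) = 0 := by
  rw [← mem_ker_relD₂, LinearMap.mem_ker]
  exact LinearMap.congr_fun (relD₂_relD₃ f) x

theorem sub_section_mem_ker {f : Γ →* G} (σ : (G →₀ ℤ) →ₗ[ℤ] (G × G →₀ ℤ) × (Γ →₀ ℤ))
    (hσ : relBoundary f ∘ₗ σ = LinearMap.id) (x) :
    x - σ (relBoundary f x) ∈ LinearMap.ker (relD₂ f) := by
  rw [mem_ker_relD₂]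
  have := LinearMap.congr_fun hσ (relBoundary f x)
  simp only [LinearMap.comp_apply, LinearMap.id_apply] at this
  simp [this]

/-- The projection of `C_2(G) ⊕ C_1(Γ)` onto the relative cycles given by a section of the
boundary. -/
noncomputable def relCycleProj {f : Γ →* G} (σ : (G →₀ ℤ) →ₗ[ℤ] (G × G →₀ ℤ) × (Γ →₀ ℤ))
    (hσ : relBoundary f ∘ₗ σ = LinearMap.id) :
    (G × G →₀ ℤ) × (Γ →₀ ℤ) →ₗ[ℤ] LinearMap.ker (relD₂ f) where
  toFun x := ⟨x - σ (relBoundary f x), sub_section_mem_ker σ hσ x⟩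
  map_add' x y := Subtype.ext (by simp only [map_add, Submodule.coe_add]; abel)
  map_smul' n x := Subtype.ext (by simp [smul_sub])

/-- The projection of `C_2(G) ⊕ C_1(Γ)` onto `H_2(G, Γ)` given by a section of the boundary. -/
noncomputable def relProj {f : Γ →* G} (σ : (G →₀ ℤ) →ₗ[ℤ] (G × G →₀ ℤ) × (Γ →₀ ℤ))
    (hσ : relBoundary f ∘ₗ σ = LinearMap.id) :
    (G × G →₀ ℤ) × (Γ →₀ ℤ) →ₗ[ℤ] RelH₂ f :=
  ((LinearMap.range (relD₃ f)).submoduleOf (LinearMap.ker (relD₂ f))).mkQ ∘ₗ relCycleProj σ hσ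

section

variable {f : Γ →* G} (σ : (G →₀ ℤ) →ₗ[ℤ] (G × G →₀ ℤ) × (Γ →₀ ℤ))
  (hσ : relBoundary f ∘ₗ σ = LinearMap.id)

theorem relProj_of_mem_ker (x : LinearMap.ker (relD₂ f)) :
    relProj σ hσ x = Submodule.Quotient.mk x := by
  have h : relBoundary f x = 0 := mem_ker_relD₂.1 x.2
  have h' : relCycleProj σ hσ x = x := by
    ext1
    simp [relCycleProj, h]
  rw [relProj, LinearMap.comp_apply, h', Submodule.mkQ_apply]

theorem relProj_relD₃ (x) : relProj σ hσ (relD₃ f x) = 0 := by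
  have h : relD₃ f x ∈ LinearMap.ker (relD₂ f) := LinearMap.congr_fun (relD₂_relD₃ f) x
  rw [relProj_of_mem_ker σ hσ ⟨_, h⟩, Submodule.Quotient.mk_eq_zero]
  exact ⟨x, rfl⟩

theorem relProj_section (x) : relProj σ hσ (σ x) = 0 := by
  have := LinearMap.congr_fun hσ x
  simp only [LinearMap.comp_apply, LinearMap.id_apply] at this
  have h' : relCycleProj σ hσ (σ x) = 0 := by
    ext1
    simp [relCycleProj, this]
  rw [relProj, LinearMap.comp_apply, h', map_zero]

/-- A homomorphism which kills the relative boundaries and the section of the differential factors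
through `H_2`. -/
theorem exists_relH₂_factor {A : Type*} [AddCommGroup A]
    (κ : (G × G →₀ ℤ) × (Γ →₀ ℤ) →ₗ[ℤ] A) (h₁ : ∀ x, κ (relD₃ f x) = 0) (h₂ : ∀ x, κ (σ x) = 0) :
    ∃ κ' : RelH₂ f →ₗ[ℤ] A, ∀ x, κ' (relProj σ hσ x) = κ x := by
  refine ⟨Submodule.liftQ _ (κ ∘ₗ Submodule.subtype _) ?_, ?_⟩
  · rintro x ⟨y, hy⟩
    change κ x = 0
    rw [← h₁ y]
    exact congrArg κ hy.symm
  · intro x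
    change κ (x - σ (relBoundary f x)) = κ x
    rw [map_sub, h₂, sub_zero]

end

end RelativeHomologyComputations

/-! ### Central extensions from 2-cocycles -/

section CocycleExtension

/-- A 2-cocycle on `G` with values in the trivial module `A`. -/
structure TwoCocycle (G : Type v) (A : Type w) [Group G] [AddCommGroup A] where
  toFun : G → G → A
  cocycle : ∀ g h k, toFun h k + toFun g (h * k) = toFun (g * h) k + toFun g h

/-- The central extension of `G` by `A` given by a 2-cocycle. -/
@[ext]
structure CocycleExtension {G : Type v} {A : Type w} [Group G] [AddCommGroup A]
    (c : TwoCocycle G A) where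
  fst : A
  snd : G

variable {G : Type v} {A : Type w} [Group G] [AddCommGroup A]

namespace TwoCocycle

variable (c : TwoCocycle G A)

theorem one_left (g : G) : c.toFun 1 g = c.toFun 1 1 := by
  have := c.cocycle 1 1 g
  simpa using this

theorem one_right (g : G) : c.toFun g 1 = c.toFun 1 1 := by
  have := c.cocycle g 1 1
  simpa using this.symm

end TwoCocycle

namespace CocycleExtension

variable {c : TwoCocycle G A}

instance : Mul (CocycleExtension c) :=
  ⟨fun x y => ⟨x.fst + y.fst + c.toFun x.snd y.snd, x.snd * y.snd⟩⟩

/-- Cocycles are not assumed normalized, so c(1, 1) enters the unit, the inverse and the inclusion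
of the kernel. -/
instance : One (CocycleExtension c) := ⟨⟨-c.toFun 1 1, 1⟩⟩

instance : Inv (CocycleExtension c) :=
  ⟨fun x => ⟨-x.fst - c.toFun x.snd⁻¹ x.snd - c.toFun 1 1, x.snd⁻¹⟩⟩

theorem mul_def (x y : CocycleExtension c) :
    x * y = ⟨x.fst + y.fst + c.toFun x.snd y.snd, x.snd * y.snd⟩ := rfl

theorem one_def : (1 : CocycleExtension c) = ⟨-c.toFun 1 1, 1⟩ := rfl

theorem inv_def (x : CocycleExtension c) :
    x⁻¹ = ⟨-x.fst - c.toFun x.snd⁻¹ x.snd - c.toFun 1 1, x.snd⁻¹⟩ := rfl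

instance : Group (CocycleExtension c) :=
  Group.ofLeftAxioms
    (by
      intro x y z
      simp only [mul_def, mul_assoc, CocycleExtension.mk.injEq, and_true]
      have := c.cocycle x.snd y.snd z.snd
      rw [add_assoc, ← sub_eq_zero]
      rw [← sub_eq_zero] at this
      rw [← neg_eq_zero, ← this]
      abel)
    (by
      intro x
      ext
      · simp [mul_def, one_def, c.one_left]
      · simp [mul_def, one_def])
    (by
      intro x
      ext
      · simp only [mul_def, one_def, inv_def]
        abel
      · simp [mul_def, one_def, inv_def])

/-- The projection of a cocycle extension. -/
def proj (c : TwoCocycle G A) : CocycleExtension c →* G :=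
  MonoidHom.mk' CocycleExtension.snd fun _ _ => rfl

@[simp]
theorem proj_apply (x : CocycleExtension c) : proj c x = x.snd := rfl

/-- The inclusion of the kernel of a cocycle extension. -/
def incl (c : TwoCocycle G A) : Multiplicative A →* CocycleExtension c :=
  MonoidHom.mk' (fun a => ⟨a.toAdd - c.toFun 1 1, 1⟩) fun a b => by
    ext
    · simp only [mul_def, toAdd_mul]
      abel
    · simp [mul_def]

theorem incl_mul (a : Multiplicative A) (x : CocycleExtension c) :
    incl c a * x = ⟨a.toAdd + x.fst, x.snd⟩ := by
  ext
  · simp only [incl, MonoidHom.mk'_apply, mul_def, c.one_left]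
    abel
  · simp [incl, mul_def]

theorem mul_incl (a : Multiplicative A) (x : CocycleExtension c) :
    x * incl c a = ⟨a.toAdd + x.fst, x.snd⟩ := by
  ext
  · simp only [incl, MonoidHom.mk'_apply, mul_def, c.one_right]
    abel
  · simp [incl, mul_def]

theorem incl_injective : Function.Injective (incl c) := by
  intro a b h
  simpa [incl] using congrArg CocycleExtension.fst h

theorem eq_incl_mul (x : CocycleExtension c) : x = incl c (.ofAdd x.fst) * ⟨0, x.snd⟩ := by
  rw [incl_mul]
  simp

theorem ker_proj : (proj c).ker = (incl c).range := by
  ext x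
  rw [MonoidHom.mem_ker, MonoidHom.mem_range]
  constructor
  · intro h
    refine ⟨.ofAdd (x.fst + c.toFun 1 1), ?_⟩
    ext
    · simp [incl]
    · simpa [incl] using h.symm
  · rintro ⟨a, rfl⟩
    rfl

theorem isCentralExtension_proj (c : TwoCocycle G A) : IsCentralExtension (proj c) := by
  refine ⟨fun g => ⟨⟨0, g⟩, rfl⟩, ?_⟩
  rw [ker_proj]
  rintro _ ⟨a, rfl⟩
  rw [Subgroup.mem_center_iff]
  intro x
  rw [incl_mul, mul_incl]

/-- The kernel of a cocycle extension is the coefficient group. -/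
noncomputable def kerEquiv (c : TwoCocycle G A) : (proj c).ker ≃* Multiplicative A :=
  (MulEquiv.subgroupCongr ker_proj).trans (MonoidHom.ofInjective incl_injective).symm

end CocycleExtension

end CocycleExtension

/-! ### Lifting through central extensions -/

section Lifting

variable {Γ : Type u} {G : Type v} [Group Γ] [Group G]

/-- A commutative group structure on the kernel of a central extension. -/
abbrev kerCommGroup {X Y : Type*} [Group X] [Group Y] {p : X →* Y}
    (hp : p.ker ≤ Subgroup.center X) : CommGroup p.ker :=
  { (inferInstance : Group p.ker) with
    mul_comm := fun a b => Subtype.ext (Subgroup.mem_center_iff.1 (hp b.2) a) }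

/-- Lifts through a central extension are determined by their restriction along a homomorphism which
is surjective on abelianizations. -/
theorem hom_eq_of_central {f : Γ →* G} (hf : Function.Surjective (Abelianization.map f))
    {X Y : Type*} [Group X] [Group Y] {p : X →* Y} (hp : p.ker ≤ Subgroup.center X)
    {τ τ' : G →* X} (h₁ : p.comp τ = p.comp τ') (h₂ : τ.comp f = τ'.comp f) : τ = τ' := by
  have hmem : ∀ g, τ g * (τ' g)⁻¹ ∈ p.ker := fun g => by
    rw [MonoidHom.mem_ker, map_mul, map_inv, mul_inv_eq_one]
    exact DFunLike.congr_fun h₁ g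
  let _ := kerCommGroup hp
  let δ : G →* p.ker := MonoidHom.mk' (fun g => ⟨_, hmem g⟩) (by
    intro g h
    ext1
    change τ (g * h) * (τ' (g * h))⁻¹ = (τ g * (τ' g)⁻¹) * (τ h * (τ' h)⁻¹)
    rw [mul_assoc (τ g), Subgroup.mem_center_iff.1 (hp (hmem h)) (τ' g)⁻¹]
    simp [mul_assoc])
  have h₃ : δ.comp f = 1 :=
    MonoidHom.ext fun γ => Subtype.ext (mul_inv_eq_one.2 (DFunLike.congr_fun h₂ γ))
  have hδ : δ = 1 := eq_one_of_comp_eq_one hf δ h₃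
  ext g
  have := congrArg Subtype.val (DFunLike.congr_fun hδ g)
  exact mul_inv_eq_one.1 this

/-- Lifting `φ : G → Y` through a central extension of `Y` by `A`, compatibly with a given lift over
`Γ`, leads to a relative cocycle; it can be normalized to vanish on a section of the boundary. -/
theorem exists_normalized_lift {f : Γ →* G} {σ : (G →₀ ℤ) →ₗ[ℤ] (G × G →₀ ℤ) × (Γ →₀ ℤ)}
    (hσ : relBoundary f ∘ₗ σ = LinearMap.id)
    {X Y A : Type*} [Group X] [Group Y] [CommGroup A] {p : X →* Y} {ι : A →* X}
    (hp : Function.Surjective p) (hι : Function.Injective ι) (hpι : p.ker ≤ ι.range)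
    (hcomm : ∀ a x, ι a * x = x * ι a) (hι₁ : ∀ a, p (ι a) = 1)
    (φ : G →* Y) (χ : Γ →* X) (hχ : p.comp χ = φ.comp f) :
    ∃ (s : G → X) (κ : (G × G →₀ ℤ) × (Γ →₀ ℤ) →ₗ[ℤ] Additive A),
      (∀ g, p (s g) = φ g) ∧
      (∀ g h, s g * s h = ι (κ (Finsupp.single (g, h) 1, 0)).toMul * s (g * h)) ∧
      (∀ γ, χ γ = ι (κ (0, Finsupp.single γ 1)).toMul * s (f γ)) ∧
      (∀ x, κ (relD₃ f x) = 0) ∧ ∀ x, κ (σ x) = 0 := by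
  choose s hs using fun g => hp (φ g)
  have hc : ∀ g h, ∃ a, ι a = s g * s h * (s (g * h))⁻¹ := fun g h => hpι (by
    simp [MonoidHom.mem_ker, hs])
  have hb : ∀ γ, ∃ a, ι a = χ γ * (s (f γ))⁻¹ := fun γ => hpι (by
    have : p (χ γ) = φ (f γ) := DFunLike.congr_fun hχ γ
    simp [MonoidHom.mem_ker, hs, this])
  choose c hc using hc
  choose b hb using hb
  replace hc : ∀ g h, s g * s h = ι (c g h) * s (g * h) := fun g h => by simp [hc]
  replace hb : ∀ γ, χ γ = ι (b γ) * s (f γ) := fun γ => by simp [hb]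
  have hcoc : ∀ g h k, c h k * c g (h * k) = c (g * h) k * c g h := by
    intro g h k
    apply hι
    apply mul_right_cancel (b := s (g * h * k))
    calc ι (c h k * c g (h * k)) * s (g * h * k)
        = ι (c h k) * (s g * s (h * k)) := by rw [hc, map_mul, mul_assoc (ι _), mul_assoc g]
      _ = s g * (s h * s k) := by rw [hc h k, ← mul_assoc, hcomm, mul_assoc]
      _ = (s g * s h) * s k := by rw [mul_assoc]
      _ = ι (c (g * h) k * c g h) * s (g * h * k) := by
        rw [hc g h, mul_assoc, hc (g * h) k, mul_comm (c _ _), map_mul, mul_assoc (ι _), mul_assoc g]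
  have hbc : ∀ γ δ, b γ * b δ * c (f γ) (f δ) = b (γ * δ) := by
    intro γ δ
    apply hι
    apply mul_right_cancel (b := s (f (γ * δ)))
    rw [← hb, map_mul χ, hb γ, hb δ, map_mul, map_mul, map_mul, mul_assoc _ _ (s _), ← hc]
    simp only [mul_assoc]
    rw [← mul_assoc (s (f γ)), ← hcomm]
    simp only [mul_assoc]
  -- The failure `c` of `s` to be multiplicative and its discrepancy `b` from `χ` form one relative
  -- 2-cochain; `hcoc` and `hbc` say that it kills boundaries.
  let κ₀ : (G × G →₀ ℤ) × (Γ →₀ ℤ) →ₗ[ℤ] Additive A :=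
    LinearMap.coprod (Finsupp.linearCombination ℤ fun x : G × G => Additive.ofMul (c x.1 x.2))
      (Finsupp.linearCombination ℤ fun γ => Additive.ofMul (b γ))
  have hκc : ∀ g h, κ₀ (Finsupp.single (g, h) 1, 0) = Additive.ofMul (c g h) := fun g h => by
    simp [κ₀]
  have hκb : ∀ γ, κ₀ (0, Finsupp.single γ 1) = Additive.ofMul (b γ) := fun γ => by
    simp [κ₀]
  have hκ₃ : κ₀ ∘ₗ relD₃ f = 0 := by
    apply LinearMap.prod_ext
    · refine Finsupp.lhom_ext' fun ⟨g, h, k⟩ => LinearMap.ext_ring ?_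
      simp only [LinearMap.comp_apply, Finsupp.lsingle_apply, LinearMap.inl_apply,
        relD₃_single_left, map_sub, map_add, hκc, LinearMap.zero_apply]
      have := congrArg Additive.ofMul (hcoc g h k)
      simp only [ofMul_mul] at this
      rw [← sub_eq_zero] at this
      rw [← this]
      abel
    · refine Finsupp.lhom_ext' fun ⟨γ, δ⟩ => LinearMap.ext_ring ?_
      simp only [LinearMap.comp_apply, Finsupp.lsingle_apply, LinearMap.inr_apply,
        relD₃_single_right, map_sub, map_add, map_neg, hκc, hκb, LinearMap.zero_apply, ← hbc,
        ofMul_mul]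
      abel
  -- Dividing `s` by `a` subtracts `κ₀ ∘ σ ∘ ∂` from the cochain. Since `∂ ∘ σ = id`, the result
  -- vanishes on `σ`.
  let a : G → A := fun g => (κ₀ (σ (Finsupp.single g 1))).toMul
  have ha : ∀ g, κ₀ (σ (Finsupp.single g 1)) = Additive.ofMul (a g) := fun g => rfl
  refine ⟨fun g => ι (a g)⁻¹ * s g, κ₀ - (κ₀ ∘ₗ σ) ∘ₗ relBoundary f, ?_, ?_, ?_, ?_, ?_⟩
  · intro g
    rw [map_mul, hι₁, one_mul, hs]
  · intro g h
    simp only [LinearMap.sub_apply, LinearMap.comp_apply, relBoundary_single_left, map_add,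
      map_sub, hκc, ha]
    rw [mul_assoc, ← mul_assoc (s g), ← hcomm, mul_assoc, hc, ← mul_assoc, ← mul_assoc, ← mul_assoc,
      ← map_mul, ← map_mul, ← map_mul]
    congr 2
    simp only [toMul_sub, toMul_add, toMul_ofMul, div_eq_mul_inv, mul_inv, inv_inv]
    rw [mul_assoc (c g h), mul_assoc (_ * _) _ (a (g * h))⁻¹]
    simp [mul_comm, mul_left_comm]
  · intro γ
    simp only [LinearMap.sub_apply, LinearMap.comp_apply, relBoundary_single_right, map_neg,
      hκb, ha]
    rw [← mul_assoc, ← map_mul, hb]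
    simp
  · intro x
    rw [LinearMap.sub_apply, LinearMap.comp_apply, relBoundary_relD₃, map_zero, sub_zero]
    exact LinearMap.congr_fun hκ₃ x
  · intro x
    have := LinearMap.congr_fun hσ x
    simp only [LinearMap.comp_apply, LinearMap.id_apply] at this
    simp [this]

/-- If the relative homology of `f : Γ → G` vanishes in degrees one and two, then homomorphisms from
`G` lift uniquely through central extensions, relative to `Γ`. -/
theorem existsUnique_lift_of_subsingleton {f : Γ →* G}
    (hf : Function.Surjective (Abelianization.map f)) (h₂ : Subsingleton (RelH₂ f))
    {X Y : Type*} [Group X] [Group Y] {p : X →* Y} (hp : IsCentralExtension p)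
    (φ : G →* Y) (χ : Γ →* X) (hχ : p.comp χ = φ.comp f) :
    ∃! τ : G →* X, p.comp τ = φ ∧ τ.comp f = χ := by
  obtain ⟨σ, hσ⟩ := exists_relBoundary_section hf
  let _ := kerCommGroup hp.2
  obtain ⟨s, κ, hs, hmul, hχs, hκ₃, hκσ⟩ := exists_normalized_lift hσ (A := p.ker)
    (ι := p.ker.subtype) hp.1 p.ker.subtype_injective (by simp)
    (fun a x => (Subgroup.mem_center_iff.1 (hp.2 a.2) x).symm) (fun a => a.2) φ χ hχ
  obtain ⟨κ', hκ'⟩ := exists_relH₂_factor σ hσ κ hκ₃ hκσ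
  -- With H_2 = 0 the whole cochain vanishes, so the normalized `s` is itself the required
  -- homomorphism.
  have hκ : ∀ x, κ x = 0 := fun x => by
    rw [← hκ', Subsingleton.elim (relProj σ hσ x) 0, map_zero]
  refine ⟨MonoidHom.mk' s fun g h => by simp [hmul, hκ], ⟨?_, ?_⟩, ?_⟩
  · ext g
    exact hs g
  · ext γ
    simp [hχs, hκ]
  · rintro τ ⟨h₁, h₃⟩
    refine hom_eq_of_central hf hp.2 ?_ ?_
    · rw [h₁]
      ext g
      exact (hs g).symm
    · rw [h₃]
      ext γ
      simp [hχs, hκ]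

end Lifting

/-! ### The extension by H_2 and its universality -/

section UniversalCover

variable {Γ : Type u} {G : Type v} [Group Γ] [Group G] {f : Γ →* G}
  (σ : (G →₀ ℤ) →ₗ[ℤ] (G × G →₀ ℤ) × (Γ →₀ ℤ)) (hσ : relBoundary f ∘ₗ σ = LinearMap.id)

/-- The cocycle of the universal central `f`-extension. -/
noncomputable def relCocycle : TwoCocycle G (RelH₂ f) where
  toFun g h := relProj σ hσ (Finsupp.single (g, h) 1, 0)
  cocycle g h k := by
    have := relProj_relD₃ σ hσ (Finsupp.single (g, h, k) 1, 0)
    rw [relD₃_single_left, map_sub, map_add, map_sub] at this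
    rw [← sub_eq_zero, ← this]
    abel

theorem relCocycle_toFun (g h : G) : (relCocycle σ hσ).toFun g h =
    relProj σ hσ (Finsupp.single (g, h) 1, 0) := rfl

/-- The structure map of the universal central `f`-extension. -/
noncomputable def relCoverη : Γ →* CocycleExtension (relCocycle σ hσ) :=
  MonoidHom.mk' (fun γ => ⟨relProj σ hσ (0, Finsupp.single γ 1), f γ⟩) (by
    intro γ δ
    ext
    · have := relProj_relD₃ σ hσ (0, Finsupp.single (γ, δ) 1)
      rw [relD₃_single_right, map_sub, map_add, map_sub, map_neg] at this
      rw [← sub_eq_zero, ← this]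
      simp only [CocycleExtension.mul_def, relCocycle_toFun]
      abel
    · simp [CocycleExtension.mul_def])

theorem relCoverη_eq (γ : Γ) : relCoverη σ hσ γ =
    CocycleExtension.incl _ (.ofAdd (relProj σ hσ (0, Finsupp.single γ 1))) * ⟨0, f γ⟩ := by
  rw [CocycleExtension.incl_mul]
  simp [relCoverη]

/-- This is what makes maps out of the cover unique. A homomorphism to an abelian group that kills Γ
restricts to α on the elements (0, g) and to β on the kernel, with β ∘ `relProj` = α ∘ ∂. Evaluating
on σ, which `relProj` kills, gives α = 0; evaluating on cycles then gives β = 0. -/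
theorem abelianization_map_relCoverη_surjective :
    Function.Surjective (Abelianization.map (relCoverη σ hσ)) := by
  refine abelianization_map_surjective_of_forall fun A _ φ hφ => ?_
  let α : (G →₀ ℤ) →ₗ[ℤ] Additive A :=
    Finsupp.linearCombination ℤ fun g => Additive.ofMul (φ ⟨0, g⟩)
  let β : RelH₂ f →ₗ[ℤ] Additive A :=
    (MonoidHom.toAdditiveRight (φ.comp (CocycleExtension.incl (relCocycle σ hσ)))).toIntLinearMap
  have hβ : ∀ y, β y = Additive.ofMul (φ (CocycleExtension.incl _ (.ofAdd y))) := fun _ => rfl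
  have hαβ : β ∘ₗ relProj σ hσ = α ∘ₗ relBoundary f := by
    apply relChain₂_hom_ext
    · intro g h
      have h1 : (⟨0, g⟩ * ⟨0, h⟩ : CocycleExtension (relCocycle σ hσ)) =
          CocycleExtension.incl _ (.ofAdd (relProj σ hσ (Finsupp.single (g, h) 1, 0))) *
            ⟨0, g * h⟩ := by
        rw [CocycleExtension.incl_mul]
        simp [CocycleExtension.mul_def, relCocycle_toFun]
      have h2 := congrArg (fun x => Additive.ofMul (φ x)) h1
      simp only [map_mul, ofMul_mul] at h2
      simp only [LinearMap.comp_apply, relBoundary_single_left, map_add, map_sub, hβ, α,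
        Finsupp.linearCombination_single, one_smul]
      rw [← sub_eq_iff_eq_add] at h2
      rw [← h2]
      abel
    · intro γ
      have h2 := congrArg (fun x => Additive.ofMul (φ x)) (relCoverη_eq σ hσ γ)
      have h3 : φ (relCoverη σ hσ γ) = 1 := DFunLike.congr_fun hφ γ
      simp only [map_mul, ofMul_mul, h3, ofMul_one] at h2
      simp only [LinearMap.comp_apply, relBoundary_single_right, map_neg, hβ, α,
        Finsupp.linearCombination_single, one_smul]
      exact eq_neg_of_add_eq_zero_left h2.symm
  have hα : ∀ x, α x = 0 := fun x => by
    have h1 := LinearMap.congr_fun hσ x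
    have h2 := LinearMap.congr_fun hαβ (σ x)
    simp only [LinearMap.comp_apply, LinearMap.id_apply] at h1 h2
    rw [← h1, ← h2, relProj_section, map_zero]
  ext x
  rw [CocycleExtension.eq_incl_mul x, map_mul, MonoidHom.one_apply]
  have h1 : φ ⟨0, x.snd⟩ = 1 := by simpa [α] using hα (Finsupp.single x.snd 1)
  have h2 : β x.fst = 0 := by
    obtain ⟨y, hy⟩ := Submodule.Quotient.mk_surjective _ x.fst
    rw [← hy, ← relProj_of_mem_ker σ hσ y]
    have := LinearMap.congr_fun hαβ y
    simp only [LinearMap.comp_apply] at this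
    rw [this, hα]
  rw [h1, mul_one]
  exact congrArg Additive.toMul h2

/-- The normalized cocycle of X factors as κ' through H_2, and (a, g) ↦ κ'(a) s(g) is the map. -/
theorem exists_relCover_hom {X : Type*} [Group X] {ψ : Γ →* X} {q : X →* G}
    (hX : IsFExtension f ψ q) (hq : IsCentralExtension q) :
    ∃ τ, IsFExtensionHom (relCoverη σ hσ) (CocycleExtension.proj _) ψ q τ := by
  let _ := kerCommGroup hq.2
  obtain ⟨s, κ, hs, hmul, hχs, hκ₃, hκσ⟩ := exists_normalized_lift hσ (A := q.ker)
    (ι := q.ker.subtype) hq.1 q.ker.subtype_injective (by simp)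
    (fun a x => (Subgroup.mem_center_iff.1 (hq.2 a.2) x).symm) (fun a => a.2)
    (MonoidHom.id G) ψ hX.2
  obtain ⟨κ', hκ'⟩ := exists_relH₂_factor σ hσ κ hκ₃ hκσ
  refine ⟨MonoidHom.mk' (fun x => ((κ' x.fst).toMul : q.ker) * s x.snd) ?_, ?_, ?_⟩
  · intro x y
    have h1 := Subgroup.mem_center_iff.1 (hq.2 (κ' y.fst).toMul.2) (s x.snd)
    simp only [CocycleExtension.mul_def, map_add, relCocycle_toFun, hκ', toMul_add, Subgroup.coe_mul]
    rw [mul_assoc, mul_assoc, mul_assoc, ← mul_assoc (s x.snd), h1, mul_assoc, hmul]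
    rfl
  · ext x
    have h1 : q ((κ' x.fst).toMul : q.ker) = 1 := (κ' x.fst).toMul.2
    simp [h1, hs]
  · ext γ
    simp only [MonoidHom.comp_apply, MonoidHom.mk'_apply, relCoverη, hκ', hχs]
    rfl

end UniversalCover

section UniversalCentralFExtension

variable {Γ G : Type u} [Group Γ] [Group G] {f : Γ →* G}

theorem isUniversalCentralFExtension_relCover
    (σ : (G →₀ ℤ) →ₗ[ℤ] (G × G →₀ ℤ) × (Γ →₀ ℤ)) (hσ : relBoundary f ∘ₗ σ = LinearMap.id) :
    IsUniversalCentralFExtension f (relCoverη σ hσ) (CocycleExtension.proj _) := by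
  have hc := CocycleExtension.isCentralExtension_proj (relCocycle σ hσ)
  refine ⟨⟨⟨hc.1, rfl⟩, hc⟩, fun E _ ψ q hE hq => ?_⟩
  obtain ⟨τ, hτ⟩ := exists_relCover_hom σ hσ hE hq
  refine ⟨τ, hτ, fun τ' hτ' => ?_⟩
  exact hom_eq_of_central (abelianization_map_relCoverη_surjective σ hσ) hq.2
    (hτ'.1.trans hτ.1.symm) (hτ'.2.trans hτ.2.symm)

theorem exists_isUniversalCentralFExtension (hf : Function.Surjective (Abelianization.map f)) :
    ∃ (U : Type u) (_ : Group U) (η : Γ →* U) (p : U →* G),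
      IsUniversalCentralFExtension f η p := by
  obtain ⟨σ, hσ⟩ := exists_relBoundary_section hf
  exact ⟨_, _, _, _, isUniversalCentralFExtension_relCover σ hσ⟩

namespace IsUniversalCentralFExtension

variable {U : Type u} [Group U] {η : Γ →* U} {p : U →* G}

/-- The structure map of a universal central `f`-extension is surjective on abelianizations. -/
theorem abelianization_map_surjective (h : IsUniversalCentralFExtension f η p) :
    Function.Surjective (Abelianization.map η) := by
  refine abelianization_map_surjective_of_forall fun A _ φ hφ => ?_
  -- Both (p, φ) and (p, 1) are maps to the split extension G × A, so uniqueness forces φ = 1.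
  obtain ⟨τ, -, hτ⟩ := h.2 (G × A) (f.prod 1) (MonoidHom.fst G A)
    ⟨Prod.fst_surjective, MonoidHom.fst_comp_prod _ _⟩ ⟨Prod.fst_surjective, by
      rintro ⟨g, a⟩ hg
      obtain rfl : g = 1 := hg
      rw [Subgroup.mem_center_iff]
      rintro ⟨g, b⟩
      simp [mul_comm]⟩
  have h1 := hτ (p.prod φ) ⟨MonoidHom.fst_comp_prod _ _, MonoidHom.ext fun γ =>
    Prod.ext (DFunLike.congr_fun h.1.1.2 γ) (DFunLike.congr_fun hφ γ)⟩
  have h2 := hτ (p.prod 1) ⟨MonoidHom.fst_comp_prod _ _, MonoidHom.ext fun γ =>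
    Prod.ext (DFunLike.congr_fun h.1.1.2 γ) rfl⟩
  have h3 := congrArg (MonoidHom.snd G A).comp (h1.trans h2.symm)
  simpa using h3

theorem exists_mulEquiv (h : IsUniversalCentralFExtension f η p)
    {U' : Type u} [Group U'] {η' : Γ →* U'} {p' : U' →* G}
    (h' : IsUniversalCentralFExtension f η' p') : ∃ e : U ≃* U', ∀ x, p' (e x) = p x := by
  obtain ⟨τ, hτ, -⟩ := h.2 U' η' p' h'.1.1 h'.1.2
  obtain ⟨τ', hτ', -⟩ := h'.2 U η p h.1.1 h.1.2
  refine ⟨MonoidHom.toMulEquiv τ τ' ?_ ?_, fun x => DFunLike.congr_fun hτ.1 x⟩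
  · refine (h.2 U η p h.1.1 h.1.2).unique ⟨?_, ?_⟩ ⟨rfl, rfl⟩
    · rw [← MonoidHom.comp_assoc, hτ'.1, hτ.1]
    · rw [MonoidHom.comp_assoc, hτ.2, hτ'.2]
  · refine (h'.2 U' η' p' h'.1.1 h'.1.2).unique ⟨?_, ?_⟩ ⟨rfl, rfl⟩
    · rw [← MonoidHom.comp_assoc, hτ.1, hτ'.1]
    · rw [MonoidHom.comp_assoc, hτ'.2, hτ.2]

/-- The kernel of a universal central `f`-extension is the relative second homology. -/
theorem nonempty_ker_mulEquiv (hf : Function.Surjective (Abelianization.map f))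
    (h : IsUniversalCentralFExtension f η p) :
    Nonempty (p.ker ≃* Multiplicative (RelH₂ f)) := by
  obtain ⟨σ, hσ⟩ := exists_relBoundary_section hf
  obtain ⟨e, he⟩ := h.exists_mulEquiv (isUniversalCentralFExtension_relCover σ hσ)
  refine ⟨MulEquiv.trans ((e.subgroupMap p.ker).trans (MulEquiv.subgroupCongr ?_))
    (CocycleExtension.kerEquiv _)⟩
  ext x
  rw [Subgroup.mem_map]
  constructor
  · rintro ⟨y, hy, rfl⟩
    exact (he y).trans hy
  · intro hx
    refine ⟨e.symm x, ?_, by simp⟩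
    rw [MonoidHom.mem_ker, ← he]
    simpa using hx

end IsUniversalCentralFExtension

/-- If `G` is its own universal central `f`-extension, then the relative second homology
vanishes. -/
theorem subsingleton_relH₂_of_isUniversal_id (hf : Function.Surjective (Abelianization.map f))
    (h : IsUniversalCentralFExtension f f (MonoidHom.id G)) : Subsingleton (RelH₂ f) := by
  obtain ⟨e⟩ := h.nonempty_ker_mulEquiv hf
  have : Subsingleton (MonoidHom.id G).ker :=
    ⟨fun a b => Subtype.ext ((show a.1 = 1 from a.2).trans (show b.1 = 1 from b.2).symm)⟩
  exact (e.symm.injective.subsingleton : Subsingleton (Multiplicative (RelH₂ f)))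

end UniversalCentralFExtension

/-! ### Commutation and generation in hypercentral extensions -/

section HypercentralExtensions

variable {Γ : Type u} {G : Type v} [Group Γ] [Group G]

theorem IsHypercentralExtension.surjective {E : Type w} [Group E] {p : E →* G}
    (h : IsHypercentralExtension E p) : Function.Surjective p := by
  induction h with
  | of_equiv E e => exact e.surjective
  | comp_central E E' p q _ hq ih => exact ih.comp hq.1

/-- Elements of coprime orders commute if one of them is in the kernel of a hypercentral
extension. -/
theorem IsHypercentralExtension.commute_of_coprime {E : Type w} [Group E] {p : E →* G}
    (h : IsHypercentralExtension E p) :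
    ∀ x u : E, p x = 1 → (orderOf x).Coprime (orderOf u) → Commute x u := by
  induction h with
  | of_equiv E e =>
    intro x u hx _
    obtain rfl : x = 1 := by simpa using hx
    exact Commute.one_left u
  | comp_central E E' p q _ hq ih =>
    intro x u hx hxu
    have h1 := ih (q x) (q u) hx
      ((hxu.coprime_dvd_left (orderOf_map_dvd q x)).coprime_dvd_right (orderOf_map_dvd q u))
    -- The commutator is central because it dies one layer down. Hence its order divides those of
    -- both x and u, which are coprime.
    set z := x * u * x⁻¹ * u⁻¹ with hz
    have hzc : ∀ y, Commute z y := fun y =>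
      (Subgroup.mem_center_iff.1 (hq.2 (show z ∈ q.ker by
        rw [MonoidHom.mem_ker, hz, map_mul, map_mul, map_mul, h1.eq, map_inv, map_inv]
        group)) y).symm
    have h2 : z ^ orderOf u = 1 := by
      have : x * u * x⁻¹ = z * u := by rw [hz]; group
      have h3 := congrArg (· ^ orderOf u) this
      simp only [conj_pow, (hzc u).mul_pow, pow_orderOf_eq_one] at h3
      simpa using h3.symm
    have h3 : z ^ orderOf x = 1 := by
      have : u * x * u⁻¹ = z⁻¹ * x := by rw [hz]; group
      have h3 := congrArg (· ^ orderOf x) this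
      simp only [conj_pow, (hzc x).inv_left.mul_pow, pow_orderOf_eq_one] at h3
      simpa using h3.symm
    have h4 : z = 1 := by
      rw [← orderOf_eq_one_iff]
      exact Nat.eq_one_of_dvd_coprimes hxu (orderOf_dvd_of_pow_eq_one h3)
        (orderOf_dvd_of_pow_eq_one h2)
    rw [hz, mul_inv_eq_one, mul_inv_eq_iff_eq_mul] at h4
    exact h4

/-- A subgroup covering the abelianization and a quotient by a central subgroup is everything. -/
theorem eq_top_of_map_eq_top_of_central {E : Type*} {E' : Type*} [Group E] [Group E']
    {q : E' →* E} (hq : q.ker ≤ Subgroup.center E') {D : Subgroup E'} (h₁ : D.map q = ⊤)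
    (h₂ : D ⊔ commutator E' = ⊤) : D = ⊤ := by
  have key : ∀ g : E', ∃ d ∈ D, ∃ a ∈ Subgroup.center E', g = d * a := by
    intro g
    obtain ⟨d, hd, hdg⟩ := (h₁ ▸ Subgroup.mem_top (q g) : q g ∈ D.map q)
    refine ⟨d, hd, d⁻¹ * g, hq ?_, by simp⟩
    rw [MonoidHom.mem_ker, map_mul, map_inv, hdg, inv_mul_cancel]
  -- Every element is in D up to a central factor, and central factors do not affect commutators.
  have hle : commutator E' ≤ D := by
    rw [commutator_def, Subgroup.commutator_le]
    intro g _ g' _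
    obtain ⟨d, hd, a, ha, rfl⟩ := key g
    obtain ⟨d', hd', a', ha', rfl⟩ := key g'
    have e1 : ∀ y, a * y * a⁻¹ = y := fun y => by
      rw [← Subgroup.mem_center_iff.1 ha, mul_inv_cancel_right]
    have e2 : ∀ y, a' * y * a'⁻¹ = y := fun y => by
      rw [← Subgroup.mem_center_iff.1 ha', mul_inv_cancel_right]
    have h : d * a * (d' * a') * (d * a)⁻¹ * (d' * a')⁻¹ = d * d' * d⁻¹ * d'⁻¹ :=
      calc _ = d * (a * (d' * a') * a⁻¹) * d⁻¹ * (d' * a')⁻¹ := by group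
        _ = d * d' * (a' * d⁻¹ * a'⁻¹) * d'⁻¹ := by rw [e1]; group
        _ = d * d' * d⁻¹ * d'⁻¹ := by rw [e2]
    change d * a * (d' * a') * (d * a)⁻¹ * (d' * a')⁻¹ ∈ D
    rw [h]
    exact D.mul_mem (D.mul_mem (D.mul_mem hd hd') (D.inv_mem hd)) (D.inv_mem hd')
  rwa [sup_eq_left.2 hle] at h₂

theorem range_sup_commutator_eq_top {f : Γ →* G}
    (hf : Function.Surjective (Abelianization.map f)) : f.range ⊔ commutator G = ⊤ := by
  rw [eq_top_iff]
  intro g _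
  obtain ⟨a, ha⟩ := hf (Abelianization.of g)
  induction a using QuotientGroup.induction_on with
  | H γ =>
    have h : (f γ)⁻¹ * g ∈ commutator G := QuotientGroup.eq.1 ha
    have := mul_mem (Subgroup.mem_sup_left (T := commutator G) (show f γ ∈ f.range from ⟨γ, rfl⟩))
      (Subgroup.mem_sup_right (S := f.range) h)
    simpa using this

theorem surjective_of_comp_surjective_of_central {E : Type*} {E' : Type*} [Group E] [Group E']
    {q : E' →* E} (hq : q.ker ≤ Subgroup.center E') {η : Γ →* E'}
    (hη : Function.Surjective (Abelianization.map η)) (h : Function.Surjective (q.comp η)) :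
    Function.Surjective η := by
  rw [← MonoidHom.range_eq_top]
  refine eq_top_of_map_eq_top_of_central hq ?_ (range_sup_commutator_eq_top hη)
  rwa [MonoidHom.map_range, MonoidHom.range_eq_top]

/-- A homomorphism to a nilpotent group is surjective if it is so on abelianizations. -/
theorem surjective_of_isNilpotent {Q : Type*} [Group Q] [Group.IsNilpotent Q] (η : Γ →* Q)
    (hη : Function.Surjective (Abelianization.map η)) : Function.Surjective η := by
  revert η
  refine Group.nilpotent_center_quotient_ind
    (P := fun Q _ _ => ∀ η : Γ →* Q, Function.Surjective (Abelianization.map η) →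
      Function.Surjective η) Q ?_ ?_
  · intro Q _ _ η _ x
    exact ⟨1, Subsingleton.elim _ _⟩
  · intro Q _ _ ih η hη
    have h := ih _ (abelianization_map_comp_surjective hη
      (QuotientGroup.mk'_surjective (Subgroup.center Q)))
    exact surjective_of_comp_surjective_of_central
      (q := QuotientGroup.mk' (Subgroup.center Q)) (by rw [QuotientGroup.ker_mk']) hη h

/-- A hypercentral extension is generated by the structure map and lifts of the elements of the
base. -/
theorem IsHypercentralExtension.closure_eq_top {E : Type w} [Group E] {p : E →* G}
    (h : IsHypercentralExtension E p) (η : Γ →* E)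
    (hη : Function.Surjective (Abelianization.map η)) (s : G → E) (hs : ∀ g, p (s g) = g) :
    Subgroup.closure (Set.range η ∪ Set.range s) = ⊤ := by
  induction h with
  | of_equiv E e =>
    rw [eq_top_iff]
    intro x _
    refine Subgroup.subset_closure (Or.inr ⟨e x, e.injective (hs (e x))⟩)
  | comp_central E E' p q _ hq ih =>
    refine eq_top_of_map_eq_top_of_central hq.2 ?_ ?_
    · rw [MonoidHom.map_closure, Set.image_union, ← Set.range_comp, ← Set.range_comp]
      exact ih (q.comp η) (abelianization_map_comp_surjective hη hq.1) (q ∘ s) hs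
    · rw [eq_top_iff, ← range_sup_commutator_eq_top hη]
      refine sup_le_sup_right ?_ _
      rintro _ ⟨γ, rfl⟩
      exact Subgroup.subset_closure (Or.inl ⟨γ, rfl⟩)

end HypercentralExtensions

/-! ### The subgroup O^ℓ(U) -/

section PResidual

variable (ℓ : ℕ) (U : Type v) [Group U]

/-- The subgroup `O^ℓ(U)` generated by the elements of order prime to `ℓ`. -/
def pResidual : Subgroup U := Subgroup.closure {u | (orderOf u).Coprime ℓ}

instance : (pResidual ℓ U).Normal := by
  refine ⟨fun n hn g => ?_⟩
  induction hn using Subgroup.closure_induction with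
  | mem x hx =>
    refine Subgroup.subset_closure ?_
    have h : orderOf (g * x * g⁻¹) = orderOf x :=
      MulEquiv.orderOf_eq (MulAut.conj g) x
    rw [Set.mem_ofPred_eq, h]
    exact hx
  | one => simp
  | mul x y _ _ hx hy => rw [← conj_mul]; exact mul_mem hx hy
  | inv x _ hx => rw [← conj_inv]; exact inv_mem hx

/-- If u has order ℓ^k m with m prime to ℓ, then u^(ℓ^k) has order m and is among the generators. -/
theorem isPGroup_quotient_pResidual [Finite U] [Fact ℓ.Prime] :
    IsPGroup ℓ (U ⧸ pResidual ℓ U) := by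
  intro x
  induction x using QuotientGroup.induction_on with
  | H u =>
    obtain ⟨k, m, hm, hk⟩ := Nat.exists_eq_pow_mul_and_not_dvd (orderOf_pos u).ne' ℓ
      (Fact.out : ℓ.Prime).ne_one
    refine ⟨k, ?_⟩
    rw [← QuotientGroup.mk_pow, QuotientGroup.eq_one_iff]
    refine Subgroup.subset_closure ?_
    rw [Set.mem_ofPred_eq, orderOf_pow_of_dvd (pow_ne_zero _ (Fact.out : ℓ.Prime).ne_zero)
      (hk ▸ dvd_mul_right _ _), hk, Nat.mul_div_cancel_left _ (pow_pos (Fact.out : ℓ.Prime).pos _)]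
    exact ((Nat.Prime.coprime_iff_not_dvd Fact.out).2 hm).symm

variable {U}

/-- Elements of `ℓ`-power order in `O^ℓ(U)` are in its commutator subgroup. -/
theorem mem_commutator_pResidual (x : pResidual ℓ U) {k : ℕ} (hx : x ^ ℓ ^ k = 1) :
    x ∈ commutator (pResidual ℓ U) := by
  -- The abelianization of O^ℓ(U) is generated by elements of order prime to ℓ, so it has no
  -- nontrivial ℓ-element.
  have key : ∀ y (hy : y ∈ pResidual ℓ U), ∃ m : ℕ, m.Coprime ℓ ∧
      (Abelianization.of (⟨y, hy⟩ : pResidual ℓ U)) ^ m = 1 := by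
    intro y hy
    induction hy using Subgroup.closure_induction with
    | mem y hy =>
      refine ⟨orderOf y, hy, ?_⟩
      rw [← map_pow, ← map_one Abelianization.of]
      congr 1
      ext1
      simp [pow_orderOf_eq_one]
    | one => exact ⟨1, Nat.coprime_one_left _, by rw [pow_one]; exact map_one _⟩
    | mul y z hy hz ihy ihz =>
      obtain ⟨m, hm, hm'⟩ := ihy
      obtain ⟨n, hn, hn'⟩ := ihz
      refine ⟨m * n, Nat.Coprime.mul_left hm hn, ?_⟩
      have : Abelianization.of (⟨y * z, mul_mem hy hz⟩ : pResidual ℓ U) =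
          Abelianization.of ⟨y, hy⟩ * Abelianization.of ⟨z, hz⟩ :=
        map_mul Abelianization.of (⟨y, hy⟩ : pResidual ℓ U) ⟨z, hz⟩
      rw [this, mul_pow, pow_mul, hm', one_pow, one_mul, mul_comm, pow_mul, hn', one_pow]
    | inv y hy ih =>
      obtain ⟨m, hm, hm'⟩ := ih
      refine ⟨m, hm, ?_⟩
      have : Abelianization.of (⟨y⁻¹, inv_mem hy⟩ : pResidual ℓ U) =
        (Abelianization.of ⟨y, hy⟩)⁻¹ :=
        map_inv Abelianization.of (⟨y, hy⟩ : pResidual ℓ U)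
      rw [this, inv_pow, hm', inv_one]
  obtain ⟨m, hm, hm'⟩ := key x.1 x.2
  have h1 : Abelianization.of x = 1 := by
    rw [← orderOf_eq_one_iff]
    refine Nat.eq_one_of_dvd_coprimes (hm.pow_right k) (orderOf_dvd_of_pow_eq_one hm')
      (orderOf_dvd_of_pow_eq_one ?_)
    rw [← map_pow, hx, map_one]
  exact (QuotientGroup.eq_one_iff x).1 h1

/-- The quotient is an ℓ-group, hence nilpotent, so surjectivity on abelianizations makes Γ surject
onto it. -/
theorem index_pResidual_dvd [Finite U] [Fact ℓ.Prime] {Γ : Type u} [Group Γ] (η : Γ →* U)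
    (hη : Function.Surjective (Abelianization.map η)) :
    (pResidual ℓ U).index ∣ Nat.card Γ := by
  have := (isPGroup_quotient_pResidual ℓ U).isNilpotent
  exact Subgroup.card_dvd_of_surjective _ (surjective_of_isNilpotent _
    (abelianization_map_comp_surjective hη (QuotientGroup.mk'_surjective (pResidual ℓ U))))

end PResidual

/-! ### Finiteness of the relative H_2 -/

section RelativeHomologyFinite

variable {Γ : Type u} {G : Type v} [Group Γ] [Group G]

/-- The homotopy `C_1 → C_2`, `[g] ↦ ∑ k, [g|k]`. -/
noncomputable def barHomotopy₁ (G : Type v) [Fintype G] : (G →₀ ℤ) →ₗ[ℤ] (G × G →₀ ℤ) :=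
  Finsupp.linearCombination ℤ fun g => ∑ k : G, Finsupp.single (g, k) 1

/-- The homotopy `C_2 → C_3`, `[g|h] ↦ ∑ k, [g|h|k]`. -/
noncomputable def barHomotopy₂ (G : Type v) [Fintype G] : (G × G →₀ ℤ) →ₗ[ℤ] (G × G × G →₀ ℤ) :=
  Finsupp.linearCombination ℤ fun x => ∑ k : G, Finsupp.single (x.1, x.2, k) 1

theorem barD₂_barHomotopy₁ [Fintype G] (y : G →₀ ℤ) :
    barD₂ G (barHomotopy₁ G y) = (Fintype.card G : ℤ) • y := by
  suffices h : barD₂ G ∘ₗ barHomotopy₁ G = (Fintype.card G : ℤ) • LinearMap.id from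
    LinearMap.congr_fun h y
  refine Finsupp.lhom_ext' fun g => LinearMap.ext_ring ?_
  simp only [barD₂, barHomotopy₁, LinearMap.comp_apply, Finsupp.lsingle_apply,
    Finsupp.linearCombination_single, one_smul, map_sum, Finset.sum_add_distrib,
    Finset.sum_sub_distrib, LinearMap.smul_apply, LinearMap.id_apply]
  rw [Fintype.sum_equiv (Equiv.mulLeft g) (fun k => Finsupp.single (g * k) (1 : ℤ))
    (fun k => Finsupp.single k 1) (fun k => rfl)]
  simp

theorem barD₃_barHomotopy₂ [Fintype G] (x : G × G →₀ ℤ) :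
    barD₃ G (barHomotopy₂ G x) =
      barHomotopy₁ G (barD₂ G x) - (Fintype.card G : ℤ) • x := by
  suffices h : barD₃ G ∘ₗ barHomotopy₂ G =
      barHomotopy₁ G ∘ₗ barD₂ G - (Fintype.card G : ℤ) • LinearMap.id from
    LinearMap.congr_fun h x
  refine Finsupp.lhom_ext' fun ⟨g, h⟩ => LinearMap.ext_ring ?_
  simp only [barD₂, barD₃, barHomotopy₁, barHomotopy₂, LinearMap.comp_apply, Finsupp.lsingle_apply,
    Finsupp.linearCombination_single, one_smul, map_sum, map_add, map_sub, Finset.sum_add_distrib,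
    Finset.sum_sub_distrib, LinearMap.smul_apply, LinearMap.id_apply, LinearMap.sub_apply]
  rw [Fintype.sum_equiv (Equiv.mulLeft h) (fun k => Finsupp.single (g, h * k) (1 : ℤ))
    (fun k => Finsupp.single (g, k) 1) (fun k => rfl)]
  simp

/-- For finite groups the relative second homology is finite: it is finitely generated, and killed
by the product of the orders. -/
theorem finite_relH₂ [Finite Γ] [Finite G] (f : Γ →* G) : Finite (RelH₂ f) := by
  cases nonempty_fintype Γ
  cases nonempty_fintype G
  have : Module.Finite ℤ (LinearMap.ker (relD₂ f)) := inferInstance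
  have : Module.Finite ℤ (RelH₂ f) := inferInstance
  refine Module.finite_of_fg_torsion _ ?_
  intro q
  refine ⟨⟨(Fintype.card G : ℤ) * Fintype.card Γ, mem_nonZeroDivisors_of_ne_zero (by simp)⟩, ?_⟩
  induction q using Submodule.Quotient.induction_on with
  | H z =>
  obtain ⟨⟨x, y⟩, hz⟩ := z
  have hz' : barD₂ G x = barMap₁ f y := by
    have := mem_ker_relD₂.1 hz
    simpa [relBoundary, sub_eq_zero] using this
  refine (Submodule.Quotient.mk_smul _ _ _).symm.trans ((Submodule.Quotient.mk_eq_zero _).2 ?_)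
  change ((Fintype.card G : ℤ) * Fintype.card Γ) • (x, y) ∈ LinearMap.range (relD₃ f)
  -- The homotopy for Γ bounds |Γ|y, which turns |Γ|x into an absolute cycle of G; the homotopy for
  -- G then bounds |G| times it.
  set x' := (Fintype.card Γ : ℤ) • x - barMap₂ f (barHomotopy₁ Γ y) with hx'
  have hd : barD₂ G x' = 0 := by
    have h := LinearMap.congr_fun (barMap₁_barD₂ f) (barHomotopy₁ Γ y)
    simp only [LinearMap.comp_apply] at h
    rw [hx', map_sub, map_smul, hz', ← h, barD₂_barHomotopy₁, map_smul, sub_self]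
  have hb := barD₃_barHomotopy₂ x'
  rw [hd, map_zero, zero_sub] at hb
  refine ⟨(-barHomotopy₂ G x', -(Fintype.card G : ℤ) • barHomotopy₁ Γ y), ?_⟩
  refine Prod.ext ?_ ?_
  · change barD₃ G (-barHomotopy₂ G x') - barMap₂ f (-(Fintype.card G : ℤ) • barHomotopy₁ Γ y) = _
    rw [map_neg, hb, map_smul, hx']
    simp only [smul_sub, neg_smul, mul_smul, Prod.smul_mk]
    abel
  · change -barD₂ Γ (-(Fintype.card G : ℤ) • barHomotopy₁ Γ y) = _
    rw [map_smul, barD₂_barHomotopy₁]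
    simp [mul_smul]

end RelativeHomologyFinite

/-! ### Bounding the order of a hypercentral extension -/

section Bound

variable {Γ : Type u} {G : Type v} [Group Γ] [Group G]

/-- Elements of order a power of `ℓ` in the kernel of a hypercentral extension commute with
`O^ℓ`. -/
theorem IsHypercentralExtension.commute_pResidual {U : Type w} [Group U] {p : U →* G}
    (h : IsHypercentralExtension U p) {ℓ k : ℕ} {x u : U} (hx : p x = 1)
    (hxk : orderOf x ∣ ℓ ^ k) (hu : u ∈ pResidual ℓ U) : Commute x u := by
  have hle : pResidual ℓ U ≤ Subgroup.centralizer {x} := by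
    refine (Subgroup.closure_le _).2 fun y hy => ?_
    rw [SetLike.mem_coe, Subgroup.mem_centralizer_singleton_iff]
    exact (h.commute_of_coprime x y hx
      ((Nat.Coprime.pow_left k (Nat.Coprime.symm hy)).coprime_dvd_left hxk)).symm
  have := hle hu
  rw [Subgroup.mem_centralizer_singleton_iff] at this
  exact this.symm

/-- The transfer: an element of the center and of the commutator subgroup is killed by the index of
the center. -/
theorem pow_index_center_eq_one {N : Type*} [Group N] [(Subgroup.center N).FiniteIndex] {x : N}
    (hx : x ∈ commutator N) : x ^ (Subgroup.center N).index = 1 := by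
  let _ : CommGroup (Subgroup.center N) :=
    { (inferInstance : Group (Subgroup.center N)) with
      mul_comm := fun a b => Subtype.ext (Subgroup.mem_center_iff.1 b.2 a) }
  have h := Abelianization.commutator_subset_ker (MonoidHom.transferCenterPow N) hx
  rw [MonoidHom.mem_ker] at h
  rw [← MonoidHom.transferCenterPow_apply, h, Subgroup.coe_one]

/-- The factor |Γ| moves x into N = O^ℓ(U), where its ℓ-power order puts it into the commutator
subgroup. The transfer then applies to the center of N, whose index has ℓ-part dividing |G|. -/
theorem IsHypercentralExtension.pow_eq_one_of_orderOf_dvd_prime_pow [Finite G]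
    {U : Type w} [Group U] [Finite U] {p : U →* G} (h : IsHypercentralExtension U p)
    {η : Γ →* U} (hη : Function.Surjective (Abelianization.map η)) {ℓ k : ℕ} (hℓ : ℓ.Prime)
    {x : U} (hx : p x = 1) (hxk : orderOf x ∣ ℓ ^ k) : x ^ (Nat.card Γ * Nat.card G) = 1 := by
  have := Fact.mk hℓ
  set N := pResidual ℓ U with hN
  have hyN : x ^ Nat.card Γ ∈ N := by
    obtain ⟨c, hc⟩ := index_pResidual_dvd ℓ η hη
    rw [hc, pow_mul]
    exact pow_mem (Subgroup.pow_index_mem _ x) c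
  let y : N := ⟨x ^ Nat.card Γ, hyN⟩
  have hyk : y ^ ℓ ^ k = 1 := by
    ext1
    change (x ^ Nat.card Γ) ^ ℓ ^ k = 1
    rw [pow_right_comm, orderOf_dvd_iff_pow_eq_one.1 hxk, one_pow]
  have hy : y ^ (Subgroup.center N).index = 1 :=
    pow_index_center_eq_one (mem_commutator_pResidual ℓ y hyk)
  obtain ⟨S⟩ : Nonempty (Sylow ℓ (p.ker.subgroupOf N)) := inferInstance
  -- A Sylow ℓ-subgroup of `ker p ∩ N` is central in N, so the index of the center divides a number
  -- prime to ℓ times the index of `ker p ∩ N`, which divides |G|.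
  have hS : (S : Subgroup _).map (p.ker.subgroupOf N).subtype ≤ Subgroup.center N := by
    rintro _ ⟨s, hs, rfl⟩
    rw [Subgroup.mem_center_iff]
    intro g
    obtain ⟨j, hj⟩ := S.isPGroup' ⟨s, hs⟩
    have hsj : orderOf (s : N).1 ∣ ℓ ^ j := by
      refine orderOf_dvd_of_pow_eq_one ?_
      have := congrArg (fun t : (S : Subgroup (p.ker.subgroupOf N)) => ((t : _) : N).1) hj
      simpa using this
    exact Subtype.ext (h.commute_pResidual s.2 hsj g.2).eq.symm
  have hdvd := Subgroup.index_dvd_of_le hS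
  rw [Subgroup.index_map_subtype] at hdvd
  have hG : (p.ker.subgroupOf N).index ∣ Nat.card G := by
    refine (Subgroup.relIndex_dvd_index_of_normal p.ker N).trans ?_
    rw [Subgroup.index_ker, MonoidHom.range_eq_top.2 h.surjective]
    simp
  have ho : orderOf y ∣ Nat.card G := by
    have h1 : (orderOf y).Coprime (S : Subgroup (p.ker.subgroupOf N)).index :=
      (Nat.Coprime.pow_left k ((Nat.Prime.coprime_iff_not_dvd hℓ).2 S.not_dvd_index)).coprime_dvd_left
        (orderOf_dvd_of_pow_eq_one hyk)
    exact (h1.dvd_of_dvd_mul_left ((orderOf_dvd_of_pow_eq_one hy).trans hdvd)).trans hG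
  have := congrArg Subtype.val (orderOf_dvd_iff_pow_eq_one.1 ho)
  rw [pow_mul]
  exact this

/-- The exponent of the kernel of a hypercentral extension is bounded. -/
theorem IsHypercentralExtension.pow_eq_one [Finite G]
    {U : Type w} [Group U] [Finite U] {p : U →* G} (h : IsHypercentralExtension U p)
    {η : Γ →* U} (hη : Function.Surjective (Abelianization.map η)) {x : U} (hx : p x = 1) :
    x ^ (Nat.card Γ * Nat.card G) = 1 := by
  rw [← orderOf_dvd_iff_pow_eq_one, Nat.dvd_iff_prime_pow_dvd_dvd]
  intro ℓ k hℓ hk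
  have h1 : orderOf (x ^ (orderOf x / ℓ ^ k)) = ℓ ^ k :=
    orderOf_pow_orderOf_div (orderOf_pos x).ne' hk
  rw [← h1]
  refine orderOf_dvd_of_pow_eq_one (h.pow_eq_one_of_orderOf_dvd_prime_pow hη hℓ ?_ h1.dvd)
  rw [map_pow, hx, one_pow]

/-- An element commuting with all elements of prime power order in a normal subgroup commutes with
all its elements of finite order. -/
theorem commute_of_forall_prime_pow {U : Type*} [Group U] [Finite U] (K : Subgroup U) {u : U}
    (h : ∀ x ∈ K, ∀ ℓ k : ℕ, ℓ.Prime → orderOf x = ℓ ^ k → Commute x u) :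
    ∀ x ∈ K, Commute x u := by
  suffices H : ∀ n : ℕ, ∀ x ∈ K, orderOf x = n → Commute x u from fun x hx => H _ x hx rfl
  intro n
  induction n using Nat.recOnPosPrimePosCoprime with
  | prime_pow ℓ k hℓ _ => exact fun x hx hk => h x hx ℓ k hℓ hk
  | zero => exact fun x _ hx => absurd hx (orderOf_pos x).ne'
  | one =>
    intro x _ hx
    rw [orderOf_eq_one_iff] at hx
    rw [hx]
    exact Commute.one_left u
  | coprime a b ha hb hab iha ihb =>
    intro x hx hn
    have h1 : Commute (x ^ a) u := ihb _ (pow_mem hx a) (by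
      rw [orderOf_pow_of_dvd (by omega) (hn ▸ dvd_mul_right _ _), hn,
        Nat.mul_div_cancel_left _ (by omega)])
    have h2 : Commute (x ^ b) u := iha _ (pow_mem hx b) (by
      rw [orderOf_pow_of_dvd (by omega) (hn ▸ dvd_mul_left _ _), hn,
        Nat.mul_div_cancel _ (by omega)])
    have h3 : x = (x ^ a) ^ a.gcdA b * (x ^ b) ^ a.gcdB b := by
      rw [← zpow_natCast, ← zpow_natCast, ← zpow_mul, ← zpow_mul, ← zpow_add,
        ← Nat.gcd_eq_gcd_ab, hab.gcd_eq_one, Nat.cast_one, zpow_one]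
    rw [h3]
    exact (h1.zpow_left _).mul_left (h2.zpow_left _)

/-- The index is a power of ℓ that divides |Γ|. Thus only the finitely many primes dividing |Γ|
matter. -/
theorem pResidual_eq_top_of_not_dvd {U : Type w} [Group U] [Finite U] {ℓ : ℕ} [Fact ℓ.Prime]
    {η : Γ →* U} (hη : Function.Surjective (Abelianization.map η)) (h : ¬ ℓ ∣ Nat.card Γ) :
    pResidual ℓ U = ⊤ := by
  obtain ⟨k, hk⟩ := IsPGroup.iff_card.1 (isPGroup_quotient_pResidual ℓ U)
  have h1 := index_pResidual_dvd ℓ η hη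
  rw [← Subgroup.index_eq_one, Subgroup.index_eq_card, hk]
  rw [Subgroup.index_eq_card, hk] at h1
  cases k with
  | zero => simp
  | succ k => exact absurd ((dvd_pow_self ℓ k.succ_ne_zero).trans h1) h

theorem IsHypercentralExtension.commute_iInf_pResidual [Finite Γ]
    {U : Type w} [Group U] [Finite U] {p : U →* G} (h : IsHypercentralExtension U p)
    {η : Γ →* U} (hη : Function.Surjective (Abelianization.map η)) {x u : U} (hx : p x = 1)
    (hu : u ∈ ⨅ ℓ : (Nat.card Γ).primeFactors, pResidual (ℓ : ℕ) U) : Commute x u := by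
  refine commute_of_forall_prime_pow p.ker (fun y hy ℓ k hℓ hk => ?_) x hx
  have := Fact.mk hℓ
  refine h.commute_pResidual hy hk.dvd ?_
  by_cases hd : ℓ ∣ Nat.card Γ
  · exact Subgroup.mem_iInf.1 hu ⟨ℓ, Nat.mem_primeFactors.2 ⟨hℓ, hd, Nat.card_pos.ne'⟩⟩
  · rw [pResidual_eq_top_of_not_dvd hη hd]
    trivial

theorem IsHypercentralExtension.rank_le [Finite Γ] [Finite G]
    {U : Type w} [Group U] [Finite U] {p : U →* G} (h : IsHypercentralExtension U p)
    {η : Γ →* U} (hη : Function.Surjective (Abelianization.map η)) :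
    Group.rank U ≤ Nat.card Γ + Nat.card G := by
  classical
  cases nonempty_fintype Γ
  cases nonempty_fintype G
  choose s hs using h.surjective
  have h1 := h.closure_eq_top η hη s hs
  have h2 : ((Finset.univ.image η ∪ Finset.univ.image s : Finset U) : Set U) =
      Set.range η ∪ Set.range s := by simp
  rw [← h2] at h1
  refine (Group.rank_le h1).trans ((Finset.card_union_le _ _).trans ?_)
  rw [Nat.card_eq_fintype_card, Nat.card_eq_fintype_card]
  exact add_le_add Finset.card_image_le Finset.card_image_le

/-- The order of a finite hypercentral extension whose structure map is surjective on
abelianizations is bounded. -/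
theorem exists_card_le_of_isHypercentralExtension (Γ : Type u) (G : Type v) [Group Γ] [Group G]
    [Finite Γ] [Finite G] : ∃ B : ℕ, ∀ (U : Type w) [Group U] [Finite U] (p : U →* G) (η : Γ →* U),
      IsHypercentralExtension U p → Function.Surjective (Abelianization.map η) →
        Nat.card U ≤ B := by
  -- `I` bounds the index of `L` in U, one factor |Γ| for each O^ℓ(U); `r` bounds the rank of `A` by
  -- Schreier's lemma, applied to `L` in U and to `A` in `L`.
  let I := ∏ _ℓ : (Nat.card Γ).primeFactors, Nat.card Γ
  let r := Nat.card G * (I * (Nat.card Γ + Nat.card G))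
  refine ⟨(Nat.card Γ * Nat.card G) ^ r * Nat.card G * I, fun U _ _ p η h hη => ?_⟩
  set L := ⨅ ℓ : (Nat.card Γ).primeFactors, pResidual (ℓ : ℕ) U with hL
  have hLI : L.index ≤ I := by
    refine (Subgroup.index_iInf_le _).trans (Finset.prod_le_prod' fun ℓ _ => ?_)
    have := Fact.mk (Nat.prime_of_mem_primeFactors ℓ.2)
    exact Nat.le_of_dvd Nat.card_pos (index_pResidual_dvd ℓ η hη)
  set A := p.ker.subgroupOf L with hA
  have hAG : A.index ≤ Nat.card G := by
    refine Nat.le_of_dvd Nat.card_pos ((Subgroup.relIndex_dvd_index_of_normal p.ker L).trans ?_)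
    rw [Subgroup.index_ker, MonoidHom.range_eq_top.2 h.surjective]
    simp
  let _ : CommGroup A :=
    { (inferInstance : Group A) with
      mul_comm := fun a b => Subtype.ext (Subtype.ext
        (h.commute_iInf_pResidual hη a.2 b.1.2).eq) }
  have hr : Group.rank A ≤ r :=
    (Subgroup.rank_le_index_mul_rank A).trans (Nat.mul_le_mul hAG
      ((Subgroup.rank_le_index_mul_rank L).trans (Nat.mul_le_mul hLI (h.rank_le hη))))
  have hM : 0 < Nat.card Γ * Nat.card G := Nat.mul_pos Nat.card_pos Nat.card_pos
  have hcard : Nat.card A ≤ (Nat.card Γ * Nat.card G) ^ r := by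
    refine (Nat.le_of_dvd (pow_pos hM _) (card_dvd_exponent_pow_rank' A fun a => ?_)).trans
      (Nat.pow_le_pow_right hM hr)
    exact Subtype.ext (Subtype.ext (h.pow_eq_one hη a.2))
  rw [← L.card_mul_index, ← A.card_mul_index]
  exact Nat.mul_le_mul (Nat.mul_le_mul hcard hAG) hLI

end Bound

/-! ### Lifting through hypercentral extensions -/

section LiftHypercentral

/-- If the relative homology of `η : Γ → L` vanishes in degrees one and two, then homomorphisms from
`L` lift uniquely through hypercentral extensions, relative to `Γ`. -/
theorem IsHypercentralExtension.existsUnique_lift {Γ : Type u} {L : Type v} {G : Type*} [Group Γ]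
    [Group L] [Group G] {η : Γ →* L} (hη : Function.Surjective (Abelianization.map η))
    (h₂ : Subsingleton (RelH₂ η)) (φ : L →* G) {M : Type w} [Group M] {q : M →* G}
    (h : IsHypercentralExtension M q) (ψ : Γ →* M) (hψ : q.comp ψ = φ.comp η) :
    ∃! τ : L →* M, q.comp τ = φ ∧ τ.comp η = ψ := by
  induction h with
  | of_equiv M e =>
    refine ⟨e.symm.toMonoidHom.comp φ, ⟨?_, ?_⟩, ?_⟩
    · ext x
      simp
    · rw [MonoidHom.comp_assoc, ← hψ]
      ext x
      simp
    · rintro τ ⟨rfl, -⟩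
      ext x
      simp
  | comp_central M M' p q _ hq ih =>
    obtain ⟨τ, ⟨hτ₁, hτ₂⟩, hτ⟩ := ih (q.comp ψ) hψ
    obtain ⟨τ', ⟨hτ'₁, hτ'₂⟩, hτ'⟩ := existsUnique_lift_of_subsingleton hη h₂ hq τ ψ hτ₂.symm
    refine ⟨τ', ⟨by rw [MonoidHom.comp_assoc, hτ'₁, hτ₁], hτ'₂⟩, ?_⟩
    rintro ρ ⟨hρ₁, hρ₂⟩
    -- Uniqueness one layer down identifies `q ∘ ρ` with `τ`, so uniqueness in the top layer
    -- applies.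
    refine hτ' ρ ⟨hτ (q.comp ρ) ⟨?_, ?_⟩, hρ₂⟩
    · rw [← MonoidHom.comp_assoc, hρ₁]
    · rw [MonoidHom.comp_assoc, hρ₂]

end LiftHypercentral

/-! ### Existence of the tower -/

section TowerExistence

/-- A group under `Γ` which is surjective on abelianizations. -/
structure AbSurjectiveUnder (Γ : Type u) [Group Γ] where
  G : Type u
  [group : Group G]
  hom : Γ →* G
  surjective : Function.Surjective (Abelianization.map hom)

attribute [instance] AbSurjectiveUnder.group

theorem AbSurjectiveUnder.exists_next {Γ : Type u} [Group Γ] (X : AbSurjectiveUnder Γ) :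
    ∃ (Y : AbSurjectiveUnder Γ) (p : Y.G →* X.G),
      IsUniversalCentralFExtension X.hom Y.hom p := by
  obtain ⟨U, _, η, p, h⟩ := exists_isUniversalCentralFExtension X.surjective
  exact ⟨⟨U, η, h.abelianization_map_surjective⟩, p, h⟩

theorem RelativeSchurTower.nonempty {Γ G : Type u} [Group Γ] [Group G] (f : Γ →* G)
    (hf : Function.Surjective (Abelianization.map f)) : Nonempty (RelativeSchurTower f) := by
  choose next p hp using fun X : AbSurjectiveUnder Γ => X.exists_next
  let X : ℕ → AbSurjectiveUnder Γ := fun n => n.rec ⟨G, f, hf⟩ fun _ => next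
  exact ⟨{
    group := fun n => (X n).group
    U := fun n => (X n).G
    η := fun n => (X n).hom
    p := fun n => p (X n)
    base := MulEquiv.refl G
    base_η := rfl
    universal := fun n => hp (X n) }⟩

end TowerExistence

/-- Elements lift to threads of an inverse sequence of surjections. -/
theorem exists_thread (n : ℕ) : ∀ {U : ℕ → Type u} (p : ∀ n, U (n + 1) → U n)
    (_ : ∀ n, Function.Surjective (p n)) (a : U n),
    ∃ x : ∀ m, U m, (∀ m, p m (x (m + 1)) = x m) ∧ x n = a := by
  induction n with
  | zero =>
    intro U p hp a
    choose s hs using hp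
    exact ⟨fun m => m.rec a fun k y => s k y, fun m => hs m _, rfl⟩
  | succ n ih =>
    intro U p hp a
    -- Drop the bottom stage, find a thread in the shifted sequence, and recover its bottom entry
    -- through `p 0`.
    obtain ⟨x, hx, hxa⟩ := ih (U := fun m => U (m + 1)) (fun m => p (m + 1)) (fun m => hp _) a
    refine ⟨fun m => Nat.casesOn m (p 0 (x 0)) x, fun m => ?_, hxa⟩
    cases m with
    | zero => rfl
    | succ m => exact hx m

/-! ### Stabilization of the tower and properties of its limit -/

namespace RelativeSchurTower

variable {Γ G : Type u} [Group Γ] [Group G] {f : Γ →* G} (T : RelativeSchurTower f)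

theorem abelianization_map_surjective (hf : Function.Surjective (Abelianization.map f)) (n : ℕ) :
    Function.Surjective (Abelianization.map (T.η n)) := by
  cases n with
  | zero =>
    have h : T.η 0 = T.base.symm.toMonoidHom.comp f := by
      ext x
      have hx : T.base (T.η 0 x) = f x := DFunLike.congr_fun T.base_η x
      simp [← hx]
    rw [h]
    exact abelianization_map_comp_surjective hf T.base.symm.surjective
  | succ n => exact (T.universal n).abelianization_map_surjective

theorem nonempty_ker_mulEquiv (hf : Function.Surjective (Abelianization.map f)) (n : ℕ) :
    Nonempty ((T.p n).ker ≃* Multiplicative (RelH₂ (T.η n))) :=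
  (T.universal n).nonempty_ker_mulEquiv (T.abelianization_map_surjective hf n)

/-- The projection `U_n → G`. -/
def toBase : ∀ n, T.U n →* G
  | 0 => T.base.toMonoidHom
  | n + 1 => (toBase n).comp (T.p n)

theorem isHypercentralExtension_toBase (n : ℕ) : IsHypercentralExtension (T.U n) (T.toBase n) := by
  induction n with
  | zero => exact .of_equiv _ T.base
  | succ n ih => exact .comp_central _ _ _ _ ih (T.universal n).1.2

theorem finite [Finite Γ] [Finite G] (hf : Function.Surjective (Abelianization.map f)) (n : ℕ) :
    Finite (T.U n) := by
  induction n with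
  | zero => exact Finite.of_equiv G T.base.symm.toEquiv
  | succ n ih =>
    obtain ⟨e⟩ := T.nonempty_ker_mulEquiv hf n
    have := finite_relH₂ (T.η n)
    have : Finite (T.p n).ker := Finite.of_equiv (RelH₂ (T.η n)) e.symm.toEquiv
    have : Finite (T.U (n + 1) ⧸ (T.p n).ker) :=
      Finite.of_injective _ (QuotientGroup.kerLift_injective (T.p n))
    exact Finite.of_equiv _ (Subgroup.groupEquivQuotientProdSubgroup (s := (T.p n).ker)).symm

/-- The tower stabilizes, since the orders of its stages are bounded. -/
theorem exists_bijective [Finite Γ] [Finite G] (hf : Function.Surjective (Abelianization.map f)) :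
    ∃ N, ∀ n, N ≤ n → Function.Bijective (T.p n) := by
  have hfin := T.finite hf
  obtain ⟨B, hB⟩ := exists_card_le_of_isHypercentralExtension.{u, u, u} Γ G
  have hbdd : BddAbove (Set.range fun n => Nat.card (T.U n)) := by
    refine ⟨B, ?_⟩
    rintro _ ⟨n, rfl⟩
    exact hB _ _ _ (T.isHypercentralExtension_toBase n) (T.abelianization_map_surjective hf n)
  -- `N` is a stage of maximal order; the orders are nondecreasing, hence constant from there on.
  obtain ⟨N, hN⟩ := Nat.sSup_mem (Set.range_nonempty _) hbdd
  have hsurj : ∀ n, Function.Surjective (T.p n) := fun n => (T.universal n).1.2.1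
  have hmono : Monotone fun n => Nat.card (T.U n) :=
    monotone_nat_of_le_succ fun n => Nat.card_le_card_of_surjective _ (hsurj n)
  refine ⟨N, fun n hn => (hsurj n).bijective_of_nat_card_le ?_⟩
  calc Nat.card (T.U (n + 1)) ≤ sSup (Set.range fun n => Nat.card (T.U n)) :=
        le_csSup hbdd ⟨n + 1, rfl⟩
    _ = Nat.card (T.U N) := hN.symm
    _ ≤ Nat.card (T.U n) := hmono hn

theorem p_comp_limitProj (n : ℕ) : (T.p n).comp (T.limitProj (n + 1)) = T.limitProj n :=
  MonoidHom.ext fun x => x.2 n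

theorem limitProj_limitη (n : ℕ) : (T.limitProj n).comp T.limitη = T.η n := rfl

theorem toBase_limitProj (n : ℕ) : (T.toBase n).comp (T.limitProj n) = T.limitMap := by
  induction n with
  | zero => rfl
  | succ n ih => rw [← ih, ← T.p_comp_limitProj n, ← MonoidHom.comp_assoc, toBase]

theorem limitProj_surjective (n : ℕ) : Function.Surjective (T.limitProj n) := by
  intro a
  obtain ⟨x, hx, hxa⟩ := exists_thread n (fun n => T.p n) (fun n => (T.universal n).1.2.1) a
  exact ⟨⟨x, hx⟩, hxa⟩

theorem limitProj_injective {N : ℕ} (hN : ∀ n, N ≤ n → Function.Injective (T.p n)) :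
    Function.Injective (T.limitProj N) := by
  intro x y hxy
  have h₁ : ∀ k, x.1 (N + k) = y.1 (N + k) := by
    intro k
    induction k with
    | zero => exact hxy
    | succ k ih =>
      exact hN (N + k) (Nat.le_add_right _ _)
        ((x.2 (N + k)).trans (ih.trans (y.2 (N + k)).symm))
  have h₂ : ∀ k m, x.1 (m + k) = y.1 (m + k) → x.1 m = y.1 m := by
    intro k
    induction k with
    | zero => exact fun m h => h
    | succ k ih =>
      intro m h
      exact ih m ((x.2 (m + k)).symm.trans ((congrArg (T.p (m + k)) h).trans (y.2 (m + k))))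
  refine Subtype.ext (funext fun m => h₂ N m ?_)
  rw [Nat.add_comm m N]
  exact h₁ m

theorem limitProj_bijective {N : ℕ} (hN : ∀ n, N ≤ n → Function.Bijective (T.p n)) :
    Function.Bijective (T.limitProj N) :=
  ⟨T.limitProj_injective fun n hn => (hN n hn).1, T.limitProj_surjective N⟩

theorem isFExtension_limit : IsFExtension f T.limitη T.limitMap :=
  ⟨T.base.surjective.comp (T.limitProj_surjective 0), T.base_η⟩

section Stable

variable {N : ℕ} (hN : Function.Bijective (T.limitProj N))
include hN

theorem isHypercentralExtension_limit : IsHypercentralExtension T.limit T.limitMap := by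
  rw [← T.toBase_limitProj N]
  -- The isomorphism from the limit to stage N counts as one more central layer, with trivial
  -- kernel.
  refine .comp_central _ _ _ _ (T.isHypercentralExtension_toBase N) ⟨hN.2, ?_⟩
  rw [(MonoidHom.ker_eq_bot_iff _).2 hN.1]
  exact bot_le

theorem abelianization_map_limitη_surjective (hf : Function.Surjective (Abelianization.map f)) :
    Function.Surjective (Abelianization.map T.limitη) := by
  let e := MulEquiv.ofBijective (T.limitProj N) hN
  have h : T.limitη = e.symm.toMonoidHom.comp (T.η N) := by
    ext1 x
    exact (e.symm_apply_apply (T.limitη x)).symm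
  rw [h]
  exact abelianization_map_comp_surjective (T.abelianization_map_surjective hf N) e.symm.surjective

/-- A central extension of the limit is one of U_N, so it receives a map from U_{N+1}; composing
with the projection from the limit to U_{N+1} splits it compatibly with Γ. -/
theorem isUniversalCentralFExtension_limit (hf : Function.Surjective (Abelianization.map f)) :
    IsUniversalCentralFExtension T.limitη T.limitη (MonoidHom.id T.limit) := by
  refine ⟨⟨⟨Function.surjective_id, rfl⟩, Function.surjective_id, ?_⟩, ?_⟩
  · intro x hx
    obtain rfl : x = 1 := hx
    exact one_mem _
  intro E _ ψ q hE hq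
  have hq' : ((T.limitProj N).comp q).ker ≤ Subgroup.center E := fun x hx =>
    hq.2 (hN.1 (hx.trans (map_one (T.limitProj N)).symm))
  obtain ⟨τ, hτ, -⟩ := (T.universal N).2 E ψ ((T.limitProj N).comp q)
    ⟨hN.2.comp hq.1, by rw [MonoidHom.comp_assoc, hE.2, limitProj_limitη]⟩ ⟨hN.2.comp hq.1, hq'⟩
  have h₁ : q.comp (τ.comp (T.limitProj (N + 1))) = MonoidHom.id T.limit := by
    refine MonoidHom.ext fun x => hN.1 ?_
    exact (DFunLike.congr_fun hτ.1 (T.limitProj (N + 1) x)).trans (x.2 N)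
  have h₂ : (τ.comp (T.limitProj (N + 1))).comp T.limitη = ψ := hτ.2
  refine ⟨τ.comp (T.limitProj (N + 1)), ⟨h₁, h₂⟩, fun τ' hτ' => ?_⟩
  exact hom_eq_of_central (T.abelianization_map_limitη_surjective hN hf) hq.2
    (hτ'.1.trans h₁.symm) (hτ'.2.trans h₂.symm)

theorem subsingleton_relH₂_limitη (hf : Function.Surjective (Abelianization.map f)) :
    Subsingleton (RelH₂ T.limitη) :=
  subsingleton_relH₂_of_isUniversal_id (T.abelianization_map_limitη_surjective hN hf)
    (T.isUniversalCentralFExtension_limit hN hf)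

end Stable

end RelativeSchurTower

theorem theorem1p5 {Γ G : Type u} [Group Γ] [Group G] [Finite Γ] [Finite G] (f : Γ →* G)
    (hf : Function.Surjective (Abelianization.map f)) :
    -- the tower of iterated universal central extensions exists
    Nonempty (RelativeSchurTower f) ∧
    ∀ T : RelativeSchurTower f,
      -- the kernel of each stage is the relative second homology group
      (∀ n, Nonempty ((T.p n).ker ≃* Multiplicative (RelH₂ (T.η n)))) ∧
      -- the tower stabilizes at a finite group
      Finite T.limit ∧
      (∃ N : ℕ, 0 < N ∧ ∀ n, N ≤ n → Function.Bijective (T.limitProj n)) ∧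
      -- the limit is a hypercentral `f`-extension, and it is initial among these
      (IsFExtension f T.limitη T.limitMap ∧ IsHypercentralExtension T.limit T.limitMap) ∧
      (∀ (M : Type w) [Group M] (ψ : Γ →* M) (q : M →* G),
        IsFExtension f ψ q → IsHypercentralExtension M q →
          ∃! τ : T.limit →* M, IsFExtensionHom T.limitη T.limitMap ψ q τ) ∧
      -- the relative homology of the limit vanishes in degrees one and two
      (Subsingleton (RelH₁ T.limitη) ∧ Subsingleton (RelH₂ T.limitη)) ∧
      -- the limit is terminal among the `f`-extensions with this property
      (∀ (E : Type w) [Group E] (ψ : Γ →* E) (q : E →* G),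
        IsFExtension f ψ q → Subsingleton (RelH₁ ψ) → Subsingleton (RelH₂ ψ) →
          ∃! τ : E →* T.limit, IsFExtensionHom ψ q T.limitη T.limitMap τ) := by
  refine ⟨RelativeSchurTower.nonempty f hf, fun T => ?_⟩
  obtain ⟨N, hN⟩ := T.exists_bijective hf
  have hbij : ∀ n, N ≤ n → Function.Bijective (T.limitProj n) := fun n hn =>
    T.limitProj_bijective fun m hm => hN m (hn.trans hm)
  have hb := hbij N le_rfl
  have hη := T.abelianization_map_limitη_surjective hb hf
  have h₂ := T.subsingleton_relH₂_limitη hb hf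
  have hhyp := T.isHypercentralExtension_limit hb
  have hfin := T.finite hf N
  refine ⟨T.nonempty_ker_mulEquiv hf, Finite.of_injective _ hb.1,
    ⟨N + 1, N.succ_pos, fun n hn => hbij n (by omega)⟩, ⟨T.isFExtension_limit, hhyp⟩, ?_,
    ⟨(subsingleton_relH₁_iff _).2 hη, h₂⟩, ?_⟩
  -- Both universal properties are the same lifting statement: here the limit is the source, lifted
  -- through M; below E is the source, lifted through the hypercentral limit.
  · intro M _ ψ q hM hq
    exact hq.existsUnique_lift hη h₂ T.limitMap ψ (hM.2.trans T.isFExtension_limit.2.symm)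
  · intro E _ ψ q hE hE₁ hE₂
    exact hhyp.existsUnique_lift ((subsingleton_relH₁_iff _).1 hE₁) hE₂ q T.limitη
      (T.isFExtension_limit.2.trans hE.2.symm)
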